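/- Let $n\ge 1$ and let $D=\Omega+i\,\mathbb{R}^{n+1}\subset\mathbb{C}^{n+1}$ be a tube domain (open and connected) whose base $\Omega\subset\mathbb{R}^{n+1}$ is affinely homogeneous, i.e. the group $\operatorname{Aff}(\Omega)$ of all invertible affine transformations $g$ of $\mathbb{R}^{n+1}$ with $g(\Omega)=\Omega$ acts transitively on $\Omega$. Let $\partial^{\mathrm{def}}\Omega$ be the part of the boundary of $\Omega$ with definite second fundamental form, i.e. the set of those $p\in\partial\Omega$ near which $\partial\Omega$ is a $C^2$ hypersurface whose second fundamental form at $p$ is positive or negative definite. Suppose that $\operatorname{Aff}(\Omega)$ acts locally transitively on $\partial^{\mathrm{def}}\Omega\neq\emptyset$, or merely on some nonempty subset $\Gamma\subset\partial^{\mathrm{def}}\Omega$ that is relatively open in $\partial\Omega$: for every $p\in\Gamma$ all points of $\Gamma$ sufficiently close to $p$ lie in the orbit $\operatorname{Aff}(\Omega)\,p$. Then $\partial^{\mathrm{def}}\Omega$ is affinely equivalent to the paraboloid \[ x_{n+1}=\sum_{i=1}^n x_i^2, \] i.e. there is an invertible affine transformation $f$ of $\mathbb{R}^{n+1}$ which maps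 $\partial^{\mathrm{def}}\Omega$ onto this paraboloid. -/

import Mathlib

open Set Filter Topology

/-- The vector of real parts of a vector of `ℂ^m`. -/
noncomputable def vecRe {m : ℕ} (z : EuclideanSpace ℂ (Fin m)) : EuclideanSpace ℝ (Fin m) :=
  WithLp.toLp 2 (fun i => (z i).re)

/-- The tube `Ω + i ℝ^m` in `ℂ^m` with base `Ω ⊆ ℝ^m`. -/
def tube {m : ℕ} (Ω : Set (EuclideanSpace ℝ (Fin m))) : Set (EuclideanSpace ℂ (Fin m)) :=
  {z | vecRe z ∈ Ω}

/-- The group of affine symmetries of a set `Ω ⊆ ℝ^m`: all invertible affine transformations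
of `ℝ^m` that map `Ω` onto itself. -/
def affineSymmetryGroup {m : ℕ} (Ω : Set (EuclideanSpace ℝ (Fin m))) :
    Subgroup (EuclideanSpace ℝ (Fin m) ≃ᵃ[ℝ] EuclideanSpace ℝ (Fin m)) where
  carrier := {g | g '' Ω = Ω}
  mul_mem' := by
    intro a b ha hb
    simp only [mem_ofPred_eq] at ha hb ⊢
    rw [AffineEquiv.coe_mul, image_comp, hb, ha]
  one_mem' := by
    simp only [mem_ofPred_eq]
    rw [AffineEquiv.coe_one, image_id]
  inv_mem' := by
    intro a ha
    simp only [mem_ofPred_eq] at ha ⊢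
    conv_lhs => rw [← ha]
    rw [← image_comp, ← AffineEquiv.coe_mul, inv_mul_cancel, AffineEquiv.coe_one, image_id]

/-- `Ω` is affinely homogeneous: its affine symmetries act transitively on it. -/
def IsAffinelyHomogeneous {m : ℕ} (Ω : Set (EuclideanSpace ℝ (Fin m))) : Prop :=
  ∀ x ∈ Ω, ∀ y ∈ Ω, ∃ g ∈ affineSymmetryGroup Ω, g x = y

/-- The affine symmetries of `Ω` act locally transitively on `Γ`: the orbit of every point `p`
of `Γ` contains a neighbourhood of `p` in `Γ`. -/
def ActsLocallyTransitivelyOn {m : ℕ} (Ω Γ : Set (EuclideanSpace ℝ (Fin m))) : Prop :=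
  ∀ p ∈ Γ, ∀ᶠ q in 𝓝[Γ] p, ∃ g ∈ affineSymmetryGroup Ω, g p = q

/-- `ρ` is a `C²` local defining function of the set `S` at the point `p ∈ S`; the set `S` is a
`C²` hypersurface near `p` if and only if it has one. -/
def IsLocalDefiningFunction {m : ℕ} (S : Set (EuclideanSpace ℝ (Fin m)))
    (p : EuclideanSpace ℝ (Fin m)) (ρ : EuclideanSpace ℝ (Fin m) → ℝ) : Prop :=
  p ∈ S ∧ ContDiffAt ℝ 2 ρ p ∧ fderiv ℝ ρ p ≠ 0 ∧ ∀ᶠ x in 𝓝 p, (x ∈ S ↔ ρ x = 0)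

/-- The tangent hyperplane at `p` of the hypersurface `ρ = 0`. -/
noncomputable def tangentHyperplane {m : ℕ} (ρ : EuclideanSpace ℝ (Fin m) → ℝ)
    (p : EuclideanSpace ℝ (Fin m)) : Submodule ℝ (EuclideanSpace ℝ (Fin m)) :=
  LinearMap.ker (fderiv ℝ ρ p : EuclideanSpace ℝ (Fin m) →ₗ[ℝ] ℝ)

/-- The second fundamental form at `p` of the hypersurface `ρ = 0` with respect to the unit
normal `∇ρ / ‖∇ρ‖`, evaluated on tangent vectors `v`, `w`. -/
noncomputable def secondFundamentalForm {m : ℕ} (ρ : EuclideanSpace ℝ (Fin m) → ℝ)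
    (p v w : EuclideanSpace ℝ (Fin m)) : ℝ :=
  -(fderiv ℝ (fderiv ℝ ρ) p v w) / ‖fderiv ℝ ρ p‖

/-- The second fundamental form at `p` of the hypersurface `ρ = 0` is (positive or negative)
definite on the tangent hyperplane. -/
def HasDefiniteSecondFundamentalForm {m : ℕ} (ρ : EuclideanSpace ℝ (Fin m) → ℝ)
    (p : EuclideanSpace ℝ (Fin m)) : Prop :=
  (∀ v ∈ tangentHyperplane ρ p, v ≠ 0 → 0 < secondFundamentalForm ρ p v v) ∨
  (∀ v ∈ tangentHyperplane ρ p, v ≠ 0 → secondFundamentalForm ρ p v v < 0)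

/-- The part of the boundary of `Ω` with definite second fundamental form: all boundary points
near which the boundary is a `C²` hypersurface and at which the second fundamental form of this
hypersurface is definite. -/
def definiteBoundaryPart {m : ℕ} (Ω : Set (EuclideanSpace ℝ (Fin m))) :
    Set (EuclideanSpace ℝ (Fin m)) :=
  {p | ∃ ρ : EuclideanSpace ℝ (Fin m) → ℝ,
    IsLocalDefiningFunction (frontier Ω) p ρ ∧ HasDefiniteSecondFundamentalForm ρ p}

/-- The paraboloid `x_{n+1} = x_1² + ⋯ + x_n²` in `ℝ^{n+1}`. -/
def paraboloid (n : ℕ) : Set (EuclideanSpace ℝ (Fin (n + 1))) :=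
  {x | x (Fin.last n) = ∑ i : Fin n, x i.castSucc ^ 2}

/-! The proof is a dimension count on infinitesimal symmetries at one definite boundary point,
placed at the origin with coordinates `(x, y)` in which the boundary is `y = ‖x‖²` to leading order
for the weights 1 and 2.

The affine symmetries of `Ω` form a closed group of linear maps of `E × ℝ`, with Lie algebra `T`. By
transitivity and a Baire argument, evaluation of `T` at an interior point is onto `E`. At the origin
its values are tangent to the boundary, so the rank is smaller. By rank-nullity, the isotropy
algebra of the origin cannot kill a given interior point: some one-parameter group of linear
symmetries of the boundary moves it (`exists_one_parameter_group_moving`).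

By parabolic blow-up, a linear symmetry is a similarity of the tangent space whose squared ratio is
its factor `χ` in the transversal direction (`linear_symmetry`). If some `χ ≠ 1`, the symmetry or
its inverse is a contraction. After a shear it becomes block diagonal, and iterating it forces the
whole boundary, not just its germ, to be the paraboloid (`eq_paraboloid_of_contraction`).

If `χ = 1` along all these groups, they act by isometries on a compact piece of the slice of the
boundary at a small height. They all fix its circumcentre, hence a vector `e` transversal to the
boundary (`exists_common_fixed_point`). The line `ℝ e` meets `Ω`, so an interior point is fixed by
every group, contradicting the first step.

Thus the boundary is affinely a paraboloid, and then every point of it is definite. -/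

/-! ### The Lie algebra of a closed linear group -/

section OneParameterSubgroups

variable {A : Type*} [NormedRing A] [NormedAlgebra ℝ A] [CompleteSpace A]

/-- The exponential of a Banach algebra, as a unit. -/
noncomputable def expUnit (X : A) : Aˣ :=
  letI : NormedAlgebra ℚ A := NormedAlgebra.restrictScalars ℚ ℝ A
  { val := NormedSpace.exp X
    inv := NormedSpace.exp (-X)
    val_inv := by
      rw [← NormedSpace.exp_add_of_commute (Commute.neg_right (Commute.refl X)), add_neg_cancel,
        NormedSpace.exp_zero]
    inv_val := by
      rw [← NormedSpace.exp_add_of_commute (Commute.neg_left (Commute.refl X)), neg_add_cancel,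
        NormedSpace.exp_zero] }

theorem val_expUnit (X : A) : (expUnit X : A) = NormedSpace.exp X := rfl

theorem inv_expUnit (X : A) : (expUnit X)⁻¹ = expUnit (-X) := by
  ext; rfl

theorem expUnit_zero : expUnit (0 : A) = 1 := by
  ext; simp [val_expUnit]

theorem expUnit_add_smul (s t : ℝ) (X : A) :
    expUnit ((s + t) • X) = expUnit (s • X) * expUnit (t • X) := by
  let _ : NormedAlgebra ℚ A := NormedAlgebra.restrictScalars ℚ ℝ A
  ext
  rw [Units.val_mul, val_expUnit, val_expUnit, val_expUnit, add_smul,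
    NormedSpace.exp_add_of_commute]
  exact ((Commute.refl X).smul_left s).smul_right t

theorem expUnit_zsmul (n : ℤ) (X : A) : expUnit (n • X) = expUnit X ^ n := by
  have key (n : ℕ) : expUnit (n • X) = expUnit X ^ n := by
    let _ : NormedAlgebra ℚ A := NormedAlgebra.restrictScalars ℚ ℝ A
    ext
    rw [Units.val_pow_eq_pow_val, val_expUnit, val_expUnit, NormedSpace.exp_nsmul]
  obtain ⟨n, rfl | rfl⟩ := n.eq_nat_or_neg
  · rw [zpow_natCast, natCast_zsmul, key]
  · rw [zpow_neg, zpow_natCast, neg_smul, natCast_zsmul, ← inv_expUnit, key]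

theorem continuous_expUnit : Continuous (expUnit : A → Aˣ) := by
  let _ : NormedAlgebra ℚ A := NormedAlgebra.restrictScalars ℚ ℝ A
  rw [Units.continuous_iff]
  refine ⟨NormedSpace.exp_continuous, ?_⟩
  simp only [inv_expUnit, val_expUnit]
  exact NormedSpace.exp_continuous.comp continuous_neg

/-- The exponential is a local diffeomorphism at `0`. -/
theorem exists_local_log : ∃ l : A → A, HasStrictFDerivAt l (1 : A →L[ℝ] A) 1 ∧ l 1 = 0 ∧
    (∀ᶠ a in 𝓝 (1 : A), NormedSpace.exp (l a) = a) := by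
  let _ : NormedAlgebra ℚ A := NormedAlgebra.restrictScalars ℚ ℝ A
  have h : HasStrictFDerivAt (NormedSpace.exp : A → A)
      ((ContinuousLinearEquiv.refl ℝ A : A ≃L[ℝ] A) : A →L[ℝ] A) 0 :=
    hasStrictFDerivAt_exp_zero
  refine ⟨h.localInverse _ _ _, ?_, ?_, ?_⟩
  · have := h.to_localInverse
    rw [NormedSpace.exp_zero] at this
    exact this
  · have := h.localInverse_apply_image
    rwa [NormedSpace.exp_zero] at this
  · have := h.eventually_right_inverse
    rwa [NormedSpace.exp_zero] at this

/-- The Lie algebra of a closed subgroup as a set: the generators of its one-parameter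
subgroups. -/
def lieSet (G : Subgroup Aˣ) : Set A := {X | ∀ t : ℝ, expUnit (t • X) ∈ G}

/-- The integer powers `exp (Y k) ^ ⌊t / r k⌋` lie in `G` and converge to `exp (t X)`, because `⌊t /
r k⌋ * r k` tends to `t`. So limit directions of small elements of `G` generate one-parameter
subgroups. -/
theorem mem_lieSet_of_tendsto {G : Subgroup Aˣ} (hG : IsClosed (G : Set Aˣ)) {Y : ℕ → A}
    {r : ℕ → ℝ} {X : A} (hr : ∀ᶠ k in atTop, 0 < r k) (hr0 : Tendsto r atTop (𝓝 0))
    (hY : ∀ᶠ k in atTop, expUnit (Y k) ∈ G)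
    (hX : Tendsto (fun k => (r k)⁻¹ • Y k) atTop (𝓝 X)) : X ∈ lieSet G := by
  intro t
  have h1 : Tendsto (fun k => (⌊t / r k⌋ : ℝ) * r k) atTop (𝓝 t) := by
    have h2 : Tendsto (fun k => t - r k) atTop (𝓝 t) := by
      simpa using tendsto_const_nhds.sub hr0
    refine tendsto_of_tendsto_of_tendsto_of_le_of_le' h2 tendsto_const_nhds ?_ ?_
    · filter_upwards [hr] with k hk
      have := (Int.sub_one_lt_floor (t / r k)).le
      have h3 : (t / r k - 1) * r k ≤ ⌊t / r k⌋ * r k := by gcongr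
      have h4 : (t / r k - 1) * r k = t - r k := by field_simp
      linarith
    · filter_upwards [hr] with k hk
      have := Int.floor_le (t / r k)
      have h3 : ⌊t / r k⌋ * r k ≤ (t / r k) * r k := by gcongr
      have h4 : (t / r k) * r k = t := by field_simp
      linarith
  have h2 : Tendsto (fun k => expUnit (⌊t / r k⌋ • Y k)) atTop (𝓝 (expUnit (t • X))) := by
    refine (continuous_expUnit.tendsto _).comp ?_
    refine (h1.smul hX).congr' ?_
    filter_upwards [hr] with k hk
    rw [smul_smul, mul_assoc, mul_inv_cancel₀ hk.ne', mul_one, Int.cast_smul_eq_zsmul]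
  refine hG.mem_of_tendsto h2 ?_
  filter_upwards [hY] with k hk
  rw [expUnit_zsmul]
  exact G.zpow_mem hk _

/-- The logarithm of `exp (s X) exp (s Y)` has derivative `X + Y` at `s = 0`, so `X + Y` is a limit
direction of elements of `G` along `s = 1 / (k + 1)`. -/
theorem add_mem_lieSet {G : Subgroup Aˣ} (hG : IsClosed (G : Set Aˣ)) {X Y : A}
    (hX : X ∈ lieSet G) (hY : Y ∈ lieSet G) : X + Y ∈ lieSet G := by
  obtain ⟨l, hl, hl1, hle⟩ := exists_local_log (A := A)
  have hexp (Z : A) : HasDerivAt (fun s : ℝ => NormedSpace.exp (s • Z)) Z 0 := by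
    simpa using hasDerivAt_exp_smul_const (𝕂 := ℝ) Z 0
  have hprod : HasDerivAt (fun s : ℝ => NormedSpace.exp (s • X) * NormedSpace.exp (s • Y))
      (X + Y) 0 := by
    simpa using (hexp X).fun_mul (hexp Y)
  have hlog : HasDerivAt (fun s : ℝ => l (NormedSpace.exp (s • X) * NormedSpace.exp (s • Y)))
      (X + Y) 0 := by
    have h1 : HasFDerivAt l (1 : A →L[ℝ] A)
      (NormedSpace.exp ((0 : ℝ) • X) * NormedSpace.exp ((0 : ℝ) • Y)) := by
      simpa using hl.hasFDerivAt
    simpa [Function.comp_def] using h1.comp_hasDerivAt (0 : ℝ) hprod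
  have hr0 : Tendsto (fun k : ℕ => 1 / ((k : ℝ) + 1)) atTop (𝓝 0) :=
    tendsto_one_div_add_atTop_nhds_zero_nat
  have hrpos (k : ℕ) : (0 : ℝ) < 1 / ((k : ℝ) + 1) := by positivity
  refine mem_lieSet_of_tendsto (r := fun k : ℕ => 1 / ((k : ℝ) + 1))
    (Y := fun k : ℕ => l (NormedSpace.exp ((1 / ((k : ℝ) + 1)) • X) *
      NormedSpace.exp ((1 / ((k : ℝ) + 1)) • Y))) hG (Eventually.of_forall hrpos) hr0 ?_ ?_
  · have h2 : Tendsto (fun k : ℕ => NormedSpace.exp ((1 / ((k : ℝ) + 1)) • X) *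
      NormedSpace.exp ((1 / ((k : ℝ) + 1)) • Y)) atTop (𝓝 1) := by
      have := hprod.continuousAt.tendsto.comp hr0
      simpa [Function.comp_def] using this
    filter_upwards [h2.eventually hle] with k hk
    have : expUnit (l (NormedSpace.exp ((1 / ((k : ℝ) + 1)) • X) *
      NormedSpace.exp ((1 / ((k : ℝ) + 1)) • Y))) =
      expUnit ((1 / ((k : ℝ) + 1)) • X) * expUnit ((1 / ((k : ℝ) + 1)) • Y) := by
      ext
      rw [val_expUnit, hk]; rfl
    rw [this]
    exact G.mul_mem (hX _) (hY _)
  · have h3 := hlog.tendsto_slope.comp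
      (tendsto_nhdsWithin_iff.2 ⟨hr0, Eventually.of_forall fun k => (hrpos k).ne'⟩)
    refine h3.congr fun k => ?_
    simp [slope_def_module, hl1]

/-- The Lie algebra of a closed subgroup of the units of a Banach algebra, as a subspace. -/
def lieSubmodule (G : Subgroup Aˣ) (hG : IsClosed (G : Set Aˣ)) : Submodule ℝ A where
  carrier := lieSet G
  add_mem' := add_mem_lieSet hG
  zero_mem' := fun t => by rw [smul_zero, expUnit_zero]; exact G.one_mem
  smul_mem' := fun c X hX t => by rw [smul_smul]; exact hX _

end OneParameterSubgroups

/-! ### Orbit directions and the Lie algebra -/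

section Operators

variable {V : Type*} [NormedAddCommGroup V] [NormedSpace ℝ V] [CompleteSpace V]

theorem hasDerivAt_exp_apply (X : V →L[ℝ] V) (v : V) :
    HasDerivAt (fun t : ℝ => NormedSpace.exp (t • X) v) (X v) 0 := by
  have h : HasDerivAt (fun s : ℝ => NormedSpace.exp (s • X)) X 0 := by
    simpa using hasDerivAt_exp_smul_const (𝕂 := ℝ) X 0
  simpa using h.clm_apply (hasDerivAt_const (0 : ℝ) v)

theorem exp_apply_of_apply_eq_zero {X : V →L[ℝ] V} {v : V} (h : X v = 0) :
    NormedSpace.exp X v = v := by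
  have h1 : HasSum (fun n : ℕ => ((n.factorial : ℝ)⁻¹ • X ^ n)) (NormedSpace.exp X) := by
    exact NormedSpace.exp_series_hasSum_exp' X
  have h2 := h1.mapL (ContinuousLinearMap.apply ℝ V v)
  refine h2.unique ?_
  convert hasSum_single (α := V) 0 ?_ using 1
  · simp
  · intro n hn
    obtain ⟨m, rfl⟩ := Nat.exists_eq_succ_of_ne_zero hn
    simp [pow_succ, h]

/-- If the orbit map of a closed linear group is open at `v`, then every direction in which
the orbit contains points tending to `v` is the value at `v` of an element of the Lie algebra. -/
theorem exists_mem_lieSubmodule_apply_eq [FiniteDimensional ℝ V] {G : Subgroup (V →L[ℝ] V)ˣ}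
    (hG : IsClosed (G : Set (V →L[ℝ] V)ˣ)) {v w : V}
    (hopen : ∀ U ∈ 𝓝 (1 : (V →L[ℝ] V)ˣ), ∀ᶠ s in 𝓝 (0 : ℝ), ∃ g ∈ G, g ∈ U ∧
      (g : V →L[ℝ] V) v = v + s • w) :
    ∃ X ∈ lieSubmodule G hG, X v = w := by
  -- Among the logarithms of elements of `G` carrying `v` to `v + s • w`, take one of minimal norm.
  -- As `s → 0` these tend to zero in a limit direction `X` that lies in the Lie algebra and, by the
  -- assumption, kills `v`. Removing the `X`-component does not change the orbit point but makes the
  -- logarithm much shorter, against minimality.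
  by_contra hcon
  obtain ⟨l, hl, hl1, hle⟩ := exists_local_log (A := V →L[ℝ] V)
  have hw : w ≠ 0 := by
    rintro rfl
    exact hcon ⟨0, Submodule.zero_mem _, by simp⟩
  set W : Submodule ℝ V := (lieSubmodule G hG).map
    ((ContinuousLinearMap.apply ℝ V v : (V →L[ℝ] V) →L[ℝ] V) : (V →L[ℝ] V) →ₗ[ℝ] V) with hW
  have hwW : w ∉ W := by
    rintro ⟨X, hX, h⟩
    exact hcon ⟨X, hX, h⟩
  let Z : ℝ → Set (V →L[ℝ] V) := fun s =>
    {Y | expUnit Y ∈ G ∧ (expUnit Y : V →L[ℝ] V) v = v + s • w}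
  have hZclosed (s : ℝ) : IsClosed (Z s) := by
    refine (hG.preimage continuous_expUnit).inter ?_
    refine isClosed_eq ?_ continuous_const
    have : Continuous fun Y : V →L[ℝ] V => (expUnit Y : V →L[ℝ] V) :=
      Units.continuous_val.comp continuous_expUnit
    exact this.clm_apply continuous_const
  have hZsmall (δ : ℝ) (hδ : 0 < δ) : ∀ᶠ s in 𝓝 (0 : ℝ), ∃ Y ∈ Z s, ‖Y‖ < δ := by
    have hU : {g : (V →L[ℝ] V)ˣ | NormedSpace.exp (l (g : V →L[ℝ] V)) = g ∧
        ‖l (g : V →L[ℝ] V)‖ < δ} ∈ 𝓝 (1 : (V →L[ℝ] V)ˣ) := by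
      have hv : Tendsto (fun g : (V →L[ℝ] V)ˣ => (g : V →L[ℝ] V)) (𝓝 1) (𝓝 1) :=
        Units.continuous_val.tendsto 1
      have h2 : Tendsto (fun a => ‖l a‖) (𝓝 1) (𝓝 0) := by
        have := hl.continuousAt.norm.tendsto
        simpa [hl1] using this
      exact hv.eventually (hle.and (h2.eventually (gt_mem_nhds hδ)))
    filter_upwards [hopen _ hU] with s hs
    obtain ⟨g, hgG, ⟨hg1, hg2⟩, hg3⟩ := hs
    have : expUnit (l (g : V →L[ℝ] V)) = g := by ext1; exact hg1
    exact ⟨l g, ⟨by rwa [this], by rwa [this]⟩, hg2⟩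
  have hmin (s : ℝ) (hs : (Z s).Nonempty) : ∃ Y ∈ Z s, ∀ Y' ∈ Z s, ‖Y‖ ≤ ‖Y'‖ := by
    obtain ⟨Y, hY, h⟩ := (hZclosed s).exists_infDist_eq_dist hs 0
    refine ⟨Y, hY, fun Y' hY' => ?_⟩
    have := Metric.infDist_le_dist_of_mem (x := (0 : V →L[ℝ] V)) hY'
    rw [h, dist_zero_left, dist_zero_left] at this
    exact this
  choose! y hyZ hymin using hmin
  set s : ℕ → ℝ := fun k => 1 / ((k : ℝ) + 1) with hsdef
  have hs0 : Tendsto s atTop (𝓝 0) := tendsto_one_div_add_atTop_nhds_zero_nat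
  have hspos (k : ℕ) : 0 < s k := by positivity
  have hne : ∀ᶠ k in atTop, (Z (s k)).Nonempty := by
    filter_upwards [hs0.eventually (hZsmall 1 one_pos)] with k hk
    obtain ⟨Y, hY, -⟩ := hk
    exact ⟨Y, hY⟩
  set Y : ℕ → V →L[ℝ] V := fun k => y (s k) with hYdef
  have hYZ : ∀ᶠ k in atTop, Y k ∈ Z (s k) := hne.mono fun k hk => hyZ _ hk
  have hYne : ∀ᶠ k in atTop, 0 < ‖Y k‖ := by
    filter_upwards [hYZ] with k hk
    rw [norm_pos_iff]
    intro h0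
    have := hk.2
    rw [h0, expUnit_zero] at this
    simp [hw, (hspos k).ne'] at this
  have hY0 : Tendsto (fun k => ‖Y k‖) atTop (𝓝 0) := by
    rw [Metric.tendsto_nhds]
    intro δ hδ
    filter_upwards [hs0.eventually (hZsmall δ hδ), hne] with k hk hk'
    obtain ⟨Y', hY', h⟩ := hk
    have := hymin _ hk' _ hY'
    simp only [dist_zero_right, norm_norm]
    exact this.trans_lt h
  obtain ⟨X, hXs, φ, hφ, hφX⟩ := (isCompact_closedBall (0 : V →L[ℝ] V) 1).tendsto_subseq
    (x := fun k => ‖Y k‖⁻¹ • Y k) (fun k => by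
      rw [mem_closedBall_zero_iff, norm_smul, norm_inv, norm_norm]
      exact inv_mul_le_one)
  have hφt := hφ.tendsto_atTop
  have hr0 : Tendsto (fun k => ‖Y (φ k)‖) atTop (𝓝 0) := hY0.comp hφt
  have hrpos : ∀ᶠ k in atTop, 0 < ‖Y (φ k)‖ := hφt.eventually hYne
  have hXT : X ∈ lieSubmodule G hG :=
    mem_lieSet_of_tendsto (r := fun k => ‖Y (φ k)‖) (Y := fun k => Y (φ k)) hG hrpos hr0
      ((hφt.eventually hYZ).mono fun k hk => hk.1) hφX
  have hYv : Tendsto (fun k => Y (φ k)) atTop (𝓝 0) := tendsto_zero_iff_norm_tendsto_zero.2 hr0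
  have hexp : HasFDerivAt (NormedSpace.exp : (V →L[ℝ] V) → V →L[ℝ] V)
      (1 : (V →L[ℝ] V) →L[ℝ] (V →L[ℝ] V)) 0 := by
    let _ : NormedAlgebra ℚ (V →L[ℝ] V) := NormedAlgebra.restrictScalars ℚ ℝ _
    exact hasStrictFDerivAt_exp_zero.hasFDerivAt
  have hexp1 : NormedSpace.exp (0 : V →L[ℝ] V) = 1 := NormedSpace.exp_zero
  have hexpY : Tendsto (fun k => ‖Y (φ k)‖⁻¹ • ((NormedSpace.exp (Y (φ k)) : V →L[ℝ] V) - 1))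
      atTop (𝓝 X) := by
    have := hexp.hasFDerivWithinAt.lim (s := univ) (c := fun k => ‖Y (φ k)‖⁻¹) hYv
      (Eventually.of_forall fun _ => mem_univ _) hφX
    simpa [hexp1] using this
  -- `exp (Y k) v - v` is a multiple of `w`, so the limit `X v` lies in `ℝ w`. It also lies in `W`,
  -- which does not contain `w`.
  have hXv : X v = 0 := by
    have h1 : Tendsto (fun k => ‖Y (φ k)‖⁻¹ • (((NormedSpace.exp (Y (φ k)) : V →L[ℝ] V) - 1) v))
        atTop (𝓝 (X v)) :=
      ((ContinuousLinearMap.apply ℝ V v).continuous.tendsto X).comp hexpY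
    have h2 : X v ∈ Submodule.span ℝ {w} := by
      refine (Submodule.closed_of_finiteDimensional (Submodule.span ℝ {w})).mem_of_tendsto h1 ?_
      filter_upwards [hφt.eventually hYZ] with k hk
      have h3 : (NormedSpace.exp (Y (φ k)) : V →L[ℝ] V) v = v + s (φ k) • w := hk.2
      rw [sub_apply, h3, one_apply_eq_self, add_sub_cancel_left]
      exact Submodule.smul_mem _ _ (Submodule.smul_mem _ _ (Submodule.mem_span_singleton_self w))
    obtain ⟨c, hc⟩ := Submodule.mem_span_singleton.1 h2
    have h3 : X v ∈ W := ⟨X, hXT, rfl⟩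
    by_cases hc0 : c = 0
    · rw [← hc, hc0, zero_smul]
    · rw [← hc] at h3
      exact absurd ((Submodule.smul_mem_iff W hc0).1 h3) hwW
  -- The correction by `exp (-‖Y‖ X)`, which fixes `v`; it cancels the first-order part of `exp Y`,
  -- leaving a logarithm of size `o(‖Y‖)`.
  set E : ℕ → V →L[ℝ] V := fun k => NormedSpace.exp ((-‖Y (φ k)‖) • X) with hE
  set h : ℕ → V →L[ℝ] V := fun k => NormedSpace.exp (Y (φ k)) * E k with hh
  have hd0 : Tendsto (fun k => (-‖Y (φ k)‖) • X) atTop (𝓝 0) := by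
    simpa using hr0.neg.smul_const X
  have hE1 : Tendsto E atTop (𝓝 1) := by
    have := hexp.continuousAt.tendsto.comp hd0
    rwa [hexp1] at this
  have hEX : Tendsto (fun k => ‖Y (φ k)‖⁻¹ • (E k - 1)) atTop (𝓝 (-X)) := by
    have := hexp.hasFDerivWithinAt.lim (s := univ) (c := fun k => ‖Y (φ k)‖⁻¹) (v := -X) hd0
      (Eventually.of_forall fun _ => mem_univ _) (by
        refine tendsto_const_nhds.congr' ?_
        filter_upwards [hrpos] with k hk
        rw [smul_smul, mul_neg, inv_mul_cancel₀ hk.ne', neg_one_smul])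
    simpa [hexp1, hE] using this
  have hhX : Tendsto (fun k => ‖Y (φ k)‖⁻¹ • (h k - 1)) atTop (𝓝 0) := by
    have := (hexpY.mul hE1).add hEX
    rw [mul_one, add_neg_cancel] at this
    refine this.congr fun k => ?_
    rw [smul_mul_assoc, ← smul_add, sub_mul, one_mul, sub_add_sub_cancel]
  have hh0 : Tendsto (fun k => h k - 1) atTop (𝓝 0) := by
    have := hr0.smul hhX
    rw [zero_smul] at this
    refine this.congr' ?_
    filter_upwards [hrpos] with k hk
    rw [smul_smul, mul_inv_cancel₀ hk.ne', one_smul]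
  have hh1 : Tendsto h atTop (𝓝 1) := by
    simpa using hh0.add_const 1
  have hlogh : Tendsto (fun k => ‖‖Y (φ k)‖⁻¹ • l (h k)‖) atTop (𝓝 0) := by
    have := hl.hasFDerivAt.hasFDerivWithinAt.lim (s := univ) (c := fun k => ‖Y (φ k)‖⁻¹) hh0
      (Eventually.of_forall fun _ => mem_univ _) hhX
    simpa [hl1] using this.norm
  have hge : ∀ᶠ k in atTop, 1 ≤ ‖‖Y (φ k)‖⁻¹ • l (h k)‖ := by
    filter_upwards [hrpos, hh1.eventually hle, hφt.eventually hYZ, hφt.eventually hne]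
      with k hk1 hk2 hk3 hk4
    have hu : expUnit (l (h k)) = expUnit (Y (φ k)) * expUnit ((-‖Y (φ k)‖) • X) := by
      ext1; exact hk2
    have hmem : l (h k) ∈ Z (s (φ k)) := by
      refine ⟨?_, ?_⟩
      · rw [hu]; exact G.mul_mem hk3.1 (hXT _)
      · rw [hu, Units.val_mul, mul_apply_eq_comp]
        have : (expUnit ((-‖Y (φ k)‖) • X) : V →L[ℝ] V) v = v :=
          exp_apply_of_apply_eq_zero (by simp [hXv])
        rw [this]; exact hk3.2
    have := hymin _ hk4 _ hmem
    rw [norm_smul, norm_inv, norm_norm, inv_mul_eq_div, one_le_div hk1]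
    exact this
  have := ge_of_tendsto hlogh hge
  linarith

end Operators

/-! ### Stabilizers of locally closed sets -/

section Stabilizer

open scoped Pointwise

variable {G X : Type*} [Group G] [TopologicalSpace G] [TopologicalSpace X]
  [MulAction G X] [ContinuousSMul G X]

/-- Group elements act by homeomorphisms and so commute with closures. For the slice of `Ω` this is
the invariance of the boundary. -/
theorem stabilizer_le_stabilizer_coborder_compl (C : Set X) :
    MulAction.stabilizer G C ≤ MulAction.stabilizer G (closure C \ C) := by
  intro g hg
  have h1 : g • closure C = closure C := by
    rw [← closure_smul, MulAction.mem_stabilizer_iff.1 hg]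
  rw [MulAction.mem_stabilizer_iff, Set.smul_set_sdiff, h1, MulAction.mem_stabilizer_iff.1 hg]

variable [IsTopologicalGroup G]

/-- The stabilizer of a locally closed set under a continuous group action is closed. -/
theorem isClosed_stabilizer_of_isLocallyClosed {C : Set X} (hC : IsLocallyClosed C) :
    IsClosed (MulAction.stabilizer G C : Set G) := by
  set S := closure C \ C with hS
  have hSc : IsClosed S := by
    have := hC.isOpen_coborder
    rwa [coborder, isOpen_compl_iff] at this
  have hsmul (v : X) : Continuous fun g : G => g • v := continuous_id.smul continuous_const
  have hsmul' (v : X) : Continuous fun g : G => g⁻¹ • v := continuous_inv.smul continuous_const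
  -- Membership becomes closed conditions on `g`: both `g` and `g⁻¹` map `C` into its closure and
  -- the closed set `S` into itself. Conversely, under these conditions a point that is moved into
  -- or out of `C` stays in the closure and cannot lie in `S`.
  have heq : (MulAction.stabilizer G C : Set G) =
      (⋂ v ∈ C, (fun g : G => g • v) ⁻¹' closure C) ∩
      (⋂ v ∈ C, (fun g : G => g⁻¹ • v) ⁻¹' closure C) ∩
      ((⋂ v ∈ S, (fun g : G => g • v) ⁻¹' S) ∩ (⋂ v ∈ S, (fun g : G => g⁻¹ • v) ⁻¹' S)) := by
    ext g
    simp only [SetLike.mem_coe, mem_inter_iff, mem_iInter, mem_preimage]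
    constructor
    · intro hg
      have hg' := inv_mem hg
      have hgS := stabilizer_le_stabilizer_coborder_compl C hg
      have hgS' := inv_mem hgS
      rw [MulAction.mem_stabilizer_set] at hg hg' hgS hgS'
      exact ⟨⟨fun v hv => subset_closure ((hg v).2 hv), fun v hv => subset_closure ((hg' v).2 hv)⟩,
        fun v hv => (hgS v).2 hv, fun v hv => (hgS' v).2 hv⟩
    · rintro ⟨⟨h1, h2⟩, h3, h4⟩
      rw [MulAction.mem_stabilizer_set]
      intro v
      constructor
      · intro hv
        have := h2 _ hv
        rw [inv_smul_smul] at this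
        by_contra hvC
        exact (h3 v ⟨this, hvC⟩).2 hv
      · intro hv
        by_contra hvC
        have := h4 _ ⟨h1 v hv, hvC⟩
        rw [inv_smul_smul] at this
        exact this.2 hv
  rw [heq]
  refine IsClosed.inter (IsClosed.inter ?_ ?_) (IsClosed.inter ?_ ?_)
  · exact isClosed_biInter fun v _ => isClosed_closure.preimage (hsmul v)
  · exact isClosed_biInter fun v _ => isClosed_closure.preimage (hsmul' v)
  · exact isClosed_biInter fun v _ => hSc.preimage (hsmul v)
  · exact isClosed_biInter fun v _ => hSc.preimage (hsmul' v)

/-- If the stabilizer of a locally closed set acts transitively on it, its orbit maps are open. -/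
theorem eventually_exists_mem_stabilizer_smul_eq [SigmaCompactSpace G] [LocallyCompactSpace X]
    [T2Space X] {C : Set X} (hC : IsLocallyClosed C)
    (htrans : ∀ v ∈ C, ∀ v' ∈ C, ∃ g ∈ MulAction.stabilizer G C, g • v = v') {v : X} (hv : v ∈ C)
    {U : Set G} (hU : U ∈ 𝓝 (1 : G)) :
    ∀ᶠ v' in 𝓝[C] v, ∃ g ∈ MulAction.stabilizer G C, g ∈ U ∧ g • v = v' := by
  have := hC.locallyCompactSpace
  have : SigmaCompactSpace (MulAction.stabilizer G C) :=
    (isClosed_stabilizer_of_isLocallyClosed hC).isClosedEmbedding_subtypeVal.sigmaCompactSpace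
  have : ContinuousSMul (MulAction.stabilizer G C) C := by
    refine ⟨Continuous.subtype_mk (f := fun p : MulAction.stabilizer G C × C =>
      (p.1 : G) • (p.2 : X)) ?_ _⟩
    fun_prop
  have : MulAction.IsPretransitive (MulAction.stabilizer G C) C := by
    refine ⟨fun a b => ?_⟩
    obtain ⟨g, hg, h⟩ := htrans a a.2 b b.2
    exact ⟨⟨g, hg⟩, Subtype.ext h⟩
  -- The open mapping theorem for transitive actions of σ-compact groups on locally compact
  -- Hausdorff, hence Baire, spaces.
  have h := (isOpenMap_smul_of_sigmaCompact (G := MulAction.stabilizer G C)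
    (⟨v, hv⟩ : C)).image_mem_nhds (x := 1) (preimage_coe_mem_nhds_subtype.2
      (mem_nhdsWithin_of_mem_nhds hU))
  rw [one_smul] at h
  obtain ⟨W, hW, hWC⟩ := (mem_nhds_subtype _ _ _).1 h
  filter_upwards [mem_nhdsWithin_of_mem_nhds hW, self_mem_nhdsWithin] with v' hv' hv'C
  obtain ⟨g, hg, hgv⟩ := hWC (show (⟨v', hv'C⟩ : C) ∈ Subtype.val ⁻¹' W from hv')
  exact ⟨g, g.2, hg, congrArg Subtype.val hgv⟩

end Stabilizer

/-! ### Affine symmetries as linear maps of `E × ℝ` -/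

section AffineGroup

open scoped Pointwise

instance continuousSMul_units_clm {V : Type*} [NormedAddCommGroup V] [NormedSpace ℝ V] :
    ContinuousSMul (V →L[ℝ] V)ˣ V :=
  ⟨(Units.continuous_val.comp continuous_fst).clm_apply continuous_snd⟩

/-- The copy of `Ω` in the hyperplane at height one of `E × ℝ`. -/
def unitSlice {E : Type*} (Ω : Set E) : Set (E × ℝ) := {v | v.1 ∈ Ω ∧ v.2 = 1}

theorem isLocallyClosed_unitSlice {E : Type*} [TopologicalSpace E] {Ω : Set E} (hΩ : IsOpen Ω) :
    IsLocallyClosed (unitSlice Ω) :=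
  (hΩ.preimage continuous_fst).isLocallyClosed.inter
    (isClosed_eq continuous_snd continuous_const).isLocallyClosed

theorem closure_unitSlice_diff {E : Type*} [TopologicalSpace E] {Ω : Set E} (hΩ : IsOpen Ω) :
    closure (unitSlice Ω) \ unitSlice Ω = unitSlice (frontier Ω) := by
  have h : unitSlice Ω = Ω ×ˢ {1} := rfl
  have h' : unitSlice (frontier Ω) = frontier Ω ×ˢ {1} := rfl
  rw [h, h', closure_prod_eq, closure_singleton, hΩ.frontier_eq]
  ext v
  simp only [Set.mem_sdiff, mem_prod, mem_singleton_iff]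
  tauto

variable {E : Type*} [NormedAddCommGroup E] [NormedSpace ℝ E]

/-- The affine symmetries of `Ω`, as linear maps of `E × ℝ`. -/
def linearizedSymmetryGroup (Ω : Set E) : Subgroup (E × ℝ →L[ℝ] E × ℝ)ˣ :=
  MulAction.stabilizer _ (unitSlice Ω)

theorem mem_linearizedSymmetryGroup {Ω : Set E} {u : (E × ℝ →L[ℝ] E × ℝ)ˣ} :
    u ∈ linearizedSymmetryGroup Ω ↔ ∀ v, (u : E × ℝ →L[ℝ] E × ℝ) v ∈ unitSlice Ω ↔
      v ∈ unitSlice Ω :=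
  MulAction.mem_stabilizer_set

theorem isClosed_linearizedSymmetryGroup {Ω : Set E} (hΩ : IsOpen Ω) :
    IsClosed (linearizedSymmetryGroup Ω : Set (E × ℝ →L[ℝ] E × ℝ)ˣ) :=
  isClosed_stabilizer_of_isLocallyClosed (isLocallyClosed_unitSlice hΩ)

theorem mem_unitSlice_frontier_iff {Ω : Set E} (hΩ : IsOpen Ω)
    {u : (E × ℝ →L[ℝ] E × ℝ)ˣ} (hu : u ∈ linearizedSymmetryGroup Ω) (v : E × ℝ) :
    (u : E × ℝ →L[ℝ] E × ℝ) v ∈ unitSlice (frontier Ω) ↔ v ∈ unitSlice (frontier Ω) := by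
  have := stabilizer_le_stabilizer_coborder_compl _ hu
  rw [closure_unitSlice_diff hΩ, MulAction.mem_stabilizer_set] at this
  exact this v

/-- Points of the slice stay at height one, and since `Ω` is open their differences span the
horizontal directions, which therefore stay at height zero. -/
theorem snd_apply_of_mem_linearizedSymmetryGroup {Ω : Set E} (hΩ : IsOpen Ω) (hne : Ω.Nonempty)
    {u : (E × ℝ →L[ℝ] E × ℝ)ˣ} (hu : u ∈ linearizedSymmetryGroup Ω) (v : E × ℝ) :
    ((u : E × ℝ →L[ℝ] E × ℝ) v).2 = v.2 := by
  obtain ⟨x, hx⟩ := hne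
  rw [mem_linearizedSymmetryGroup] at hu
  have h1 (y : E) (hy : y ∈ Ω) : ((u : E × ℝ →L[ℝ] E × ℝ) (y, 1)).2 = 1 :=
    ((hu (y, 1)).2 ⟨hy, rfl⟩).2
  have h2 (w : E) : ((u : E × ℝ →L[ℝ] E × ℝ) (w, 0)).2 = 0 := by
    have h3 : ∀ᶠ s in 𝓝[≠] (0 : ℝ), x + s • w ∈ Ω := by
      refine nhdsWithin_le_nhds (ContinuousAt.preimage_mem_nhds ?_
        (hΩ.mem_nhds (by simpa using hx)))
      fun_prop
    obtain ⟨s, hs, hs0⟩ := (h3.and self_mem_nhdsWithin).exists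
    have h4 : ((x + s • w, 1) : E × ℝ) = (x, 1) + s • (w, 0) := by simp
    have h5 := h1 _ hs
    rw [h4, map_add, map_smul, Prod.snd_add, h1 x hx, Prod.smul_snd] at h5
    have h6 : s • ((u : E × ℝ →L[ℝ] E × ℝ) (w, 0)).2 = 0 := by linarith
    exact (smul_eq_zero.1 h6).resolve_left hs0
  have h3 : v = (v.1 - v.2 • x, 0) + v.2 • (x, 1) := by ext <;> simp
  rw [h3, map_add, map_smul, Prod.snd_add, h2, Prod.smul_snd, h1 x hx]
  simp

/-- The infinitesimal affine symmetries of a homogeneous open set take all values at each of its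
points. -/
theorem exists_mem_lieSubmodule_linearizedSymmetryGroup [FiniteDimensional ℝ E] {Ω : Set E}
    (hΩ : IsOpen Ω)
    (htrans : ∀ x ∈ Ω, ∀ y ∈ Ω, ∃ u ∈ linearizedSymmetryGroup Ω,
      (u : E × ℝ →L[ℝ] E × ℝ) (x, 1) = (y, 1))
    (hG : IsClosed (linearizedSymmetryGroup Ω : Set (E × ℝ →L[ℝ] E × ℝ)ˣ))
    {x : E} (hx : x ∈ Ω) (w : E) :
    ∃ X ∈ lieSubmodule (linearizedSymmetryGroup Ω) hG, X (x, 1) = (w, 0) := by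
  have : ProperSpace (E × ℝ →L[ℝ] E × ℝ) := FiniteDimensional.proper_real _
  have : ProperSpace (E × ℝ) := FiniteDimensional.proper_real _
  have : SigmaCompactSpace (E × ℝ →L[ℝ] E × ℝ)ˣ :=
    Units.isClosedEmbedding_embedProduct.sigmaCompactSpace
  refine exists_mem_lieSubmodule_apply_eq hG fun U hU => ?_
  have h := eventually_exists_mem_stabilizer_smul_eq (isLocallyClosed_unitSlice hΩ)
    (fun v hv v' hv' => ?_) (⟨hx, rfl⟩ : (x, 1) ∈ unitSlice Ω) hU
  · have h1 : Tendsto (fun s : ℝ => ((x, 1) : E × ℝ) + s • (w, 0)) (𝓝 0)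
        (𝓝[unitSlice Ω] (x, 1)) := by
      rw [tendsto_nhdsWithin_iff]
      constructor
      · refine Continuous.tendsto' ?_ _ _ (by simp)
        fun_prop
      · have h3 : ∀ᶠ s in 𝓝 (0 : ℝ), x + s • w ∈ Ω := by
          refine (ContinuousAt.preimage_mem_nhds ?_
        (hΩ.mem_nhds (by simpa using hx)))
          fun_prop
        filter_upwards [h3] with s hs
        exact ⟨by simpa using hs, by simp⟩
    exact h1.eventually h
  · obtain ⟨y, t⟩ := v
    obtain ⟨y', t'⟩ := v'
    obtain ⟨hy, rfl⟩ := hv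
    obtain ⟨hy', rfl⟩ := hv'
    exact htrans y hy y' hy'

/-- An invertible affine map of `E` extends to an invertible linear map of `E × ℝ`. -/
theorem AffineEquiv.exists_linearization [FiniteDimensional ℝ E] (g : E ≃ᵃ[ℝ] E) :
    ∃ u : (E × ℝ →L[ℝ] E × ℝ)ˣ, ∀ v : E × ℝ,
      (u : E × ℝ →L[ℝ] E × ℝ) v = (g.linear v.1 + v.2 • g 0, v.2) := by
  let L (g : E ≃ᵃ[ℝ] E) : E × ℝ →ₗ[ℝ] E × ℝ :=
    { toFun := fun v => (g.linear v.1 + v.2 • g 0, v.2)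
      map_add' := fun v w => by
        ext
        · simp only [Prod.fst_add, Prod.snd_add, map_add, add_smul]; abel
        · simp
      map_smul' := fun c v => by ext <;> simp [smul_smul] }
  have key (g : E ≃ᵃ[ℝ] E) (v : E × ℝ) : L g (L g.symm v) = v := by
    have h : g (g.symm 0) = g.linear (g.symm 0) + g 0 := by
      simpa using g.map_vadd 0 (g.symm 0)
    rw [AffineEquiv.apply_symm_apply] at h
    ext
    · change g.linear (g.symm.linear v.1 + v.2 • g.symm 0) + v.2 • g 0 = v.1
      rw [map_add, map_smul, add_assoc, ← smul_add, ← h, smul_zero, add_zero]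
      exact g.linear.apply_symm_apply _
    · rfl
  refine ⟨⟨LinearMap.toContinuousLinearMap (L g), LinearMap.toContinuousLinearMap (L g.symm),
    ?_, ?_⟩, fun v => rfl⟩
  · exact DFunLike.ext _ _ fun v => key g v
  · exact DFunLike.ext _ _ fun v => key g.symm v

end AffineGroup

/-! ### The circumcentre of a bounded set -/

/-- A bounded nonempty set in a Euclidean space has a centre (the centre of its smallest enclosing
ball), which is fixed by its isometries. -/
theorem exists_fixed_point_of_isometry {F : Type*} [NormedAddCommGroup F] [InnerProductSpace ℝ F]
    [FiniteDimensional ℝ F] {K : Set F} (hK : Bornology.IsBounded K) (hne : K.Nonempty) :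
    ∃ b : F, ∀ A : F → F, Isometry A → K ⊆ A '' K → A b = b := by
  have : ProperSpace F := FiniteDimensional.proper_real F
  obtain ⟨k₀, hk₀⟩ := hne
  set r : F → ℝ := fun b => sSup ((fun k => dist k b) '' K) with hr
  have hle (b k : F) (hk : k ∈ K) : dist k b ≤ r b := by
    refine le_csSup ?_ (mem_image_of_mem _ hk)
    obtain ⟨R, hR⟩ := hK.subset_closedBall b
    exact ⟨R, by rintro _ ⟨k, hk, rfl⟩; exact hR hk⟩
  have hge (b : F) (R : ℝ) (h : ∀ k ∈ K, dist k b ≤ R) : r b ≤ R :=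
    csSup_le ⟨_, mem_image_of_mem _ hk₀⟩ (by rintro _ ⟨k, hk, rfl⟩; exact h k hk)
  have hcont : Continuous r := by
    refine (LipschitzWith.of_le_add fun b b' => ?_).continuous
    refine hge _ _ fun k hk => ?_
    have h1 := dist_triangle k b' b
    have h2 := hle b' k hk
    rw [dist_comm b' b] at h1
    linarith
  have hlim : Tendsto r (cocompact F) atTop :=
    tendsto_atTop_mono (fun b => hle b k₀ hk₀) (tendsto_dist_left_cocompact_atTop k₀)
  obtain ⟨b, hb⟩ := hcont.exists_forall_le hlim
  refine ⟨b, fun A hA hKA => ?_⟩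
  have hAb : r (A b) ≤ r b := by
    refine hge _ _ fun k hk => ?_
    obtain ⟨k', hk', rfl⟩ := hKA hk
    rw [hA.dist_eq]
    exact hle b k' hk'
  -- Both `b` and `A b` are centres of enclosing balls of minimal radius. By the parallelogram law
  -- their midpoint would have a smaller enclosing radius unless they coincide.
  set m : F := (1 / 2 : ℝ) • (A b + b) with hm
  have h0 : 0 ≤ r b := dist_nonneg.trans (hle b k₀ hk₀)
  have hsq (k : F) (hk : k ∈ K) : dist k m ^ 2 ≤ r b ^ 2 - ‖A b - b‖ ^ 2 / 4 := by
    have h1 := hle b k hk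
    have h2 := (hle (A b) k hk).trans hAb
    have h3 := parallelogram_law_with_norm ℝ (k - A b) (k - b)
    have h4 : (k - A b) + (k - b) = (2 : ℝ) • (k - m) := by
      rw [hm]; module
    have h5 : (k - A b) - (k - b) = -(A b - b) := by abel
    rw [h4, h5, norm_neg, norm_smul, ← dist_eq_norm k b, ← dist_eq_norm k (A b),
      ← dist_eq_norm k m, Real.norm_ofNat] at h3
    have h6 : dist k b * dist k b ≤ r b * r b := by gcongr
    have h7 : dist k (A b) * dist k (A b) ≤ r b * r b := by gcongr
    nlinarith
  have hnn : 0 ≤ r b ^ 2 - ‖A b - b‖ ^ 2 / 4 := (sq_nonneg _).trans (hsq k₀ hk₀)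
  have h1 : r m ≤ √(r b ^ 2 - ‖A b - b‖ ^ 2 / 4) :=
    hge _ _ fun k hk => Real.le_sqrt_of_sq_le (hsq k hk)
  have h2 := (hb m).trans h1
  have h3 : r b ^ 2 ≤ r b ^ 2 - ‖A b - b‖ ^ 2 / 4 := by
    calc r b ^ 2 ≤ √(r b ^ 2 - ‖A b - b‖ ^ 2 / 4) ^ 2 := by gcongr
      _ = _ := Real.sq_sqrt hnn
  have h4 : ‖A b - b‖ ^ 2 = 0 := le_antisymm (by linarith) (sq_nonneg _)
  exact sub_eq_zero.1 (norm_eq_zero.1 (pow_eq_zero_iff two_ne_zero |>.1 h4))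

/-! ### Transversal lines meet the open set -/

section Sides

variable {E : Type*} [NormedAddCommGroup E] [NormedSpace ℝ E]

/-- Off the frontier, the space splits into the disjoint open sets `Ω` and the exterior of `Ω`. -/
theorem IsPreconnected.subset_of_disjoint_frontier {X : Type*} [TopologicalSpace X] {t Ω : Set X}
    (ht : IsPreconnected t) (hΩ : IsOpen Ω) (h : (t ∩ Ω).Nonempty) (hd : Disjoint t (frontier Ω)) :
    t ⊆ Ω := by
  refine ht.subset_left_of_subset_union hΩ isClosed_closure.isOpen_compl
    (disjoint_compl_right.mono_left subset_closure) (fun x hx => ?_) h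
  by_contra hcon
  simp only [mem_union, mem_compl_iff, not_or, not_not] at hcon
  exact Set.disjoint_left.1 hd hx (hΩ.frontier_eq ▸ ⟨hcon.2, hcon.1⟩)

/-- If `Ω` accumulates at `0` from the positive side of a local defining function of its boundary,
then it contains points of every line transversal to the boundary. -/
theorem exists_smul_mem_of_frequently_pos {Ω : Set E} (hΩ : IsOpen Ω) {ρ : E → ℝ} {ℓ : E →L[ℝ] ℝ}
    (hder : HasStrictFDerivAt ρ ℓ 0) (h0 : ρ 0 = 0) (hfr : ∀ᶠ z in 𝓝 0, z ∈ frontier Ω → ρ z = 0)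
    {e : E} (he : 0 < ℓ e) (hq : ∃ᶠ q in 𝓝 0, q ∈ Ω ∧ 0 < ρ q) : ∃ s : ℝ, s • e ∈ Ω := by
  have he0 : 0 < ‖e‖ := by
    rw [norm_pos_iff]; rintro rfl; simp at he
  set c := ℓ e with hc
  -- With this error constant, strict differentiability makes `ρ` grow at rate at least `c / 2`
  -- along `e`.
  set ε := c / (2 * ‖e‖) with hε
  have hεpos : 0 < ε := by positivity
  have hεe : ε * ‖e‖ = c / 2 := by rw [hε]; field_simp
  obtain ⟨N, hN, happ⟩ := hder.approximates_deriv_on_nhds (c := ⟨ε, hεpos.le⟩) (Or.inr hεpos)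
  have happ' (x : E) (hx : x ∈ N) (y : E) (hy : y ∈ N) :
      |ρ x - ρ y - ℓ (x - y)| ≤ ε * ‖x - y‖ := happ x hx y hy
  obtain ⟨δ, hδ, hball⟩ := Metric.mem_nhds_iff.1 (inter_mem hN hfr)
  have hN' (x : E) (hx : ‖x‖ < δ) : x ∈ N := (hball (mem_ball_zero_iff.2 hx)).1
  have hfr' (x : E) (hx : ‖x‖ < δ) : x ∈ frontier Ω → ρ x = 0 := (hball (mem_ball_zero_iff.2 hx)).2
  set s := δ / (2 * ‖e‖) with hs
  have hspos : 0 < s := by positivity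
  have hse : s * ‖e‖ = δ / 2 := by rw [hs]; field_simp
  have hℓ : Tendsto (fun q : E => ‖ℓ‖ * ‖q‖ + ε * ‖q‖) (𝓝 0) (𝓝 0) := by
    refine Continuous.tendsto' (by fun_prop) _ _ (by simp)
  have hsmall : ∀ᶠ q in 𝓝 (0 : E), ‖q‖ < δ / 2 ∧ ‖ℓ‖ * ‖q‖ + ε * ‖q‖ < s * (c / 2) :=
    (show ∀ᶠ q in 𝓝 (0 : E), ‖q‖ < δ / 2 from
      (continuous_norm.tendsto' 0 0 norm_zero).eventually (gt_mem_nhds (half_pos hδ))).and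
      (hℓ.eventually (gt_mem_nhds (by positivity)))
  obtain ⟨q, ⟨hqΩ, hqρ⟩, hqδ, hqs⟩ := (hq.and_eventually hsmall).exists
  have hup (x : E) (hx : ‖x‖ < δ / 2) (τ : ℝ) (hτ0 : 0 ≤ τ) (hτs : τ ≤ s) :
      ‖x + τ • e‖ < δ ∧ ρ x + τ * (c / 2) ≤ ρ (x + τ • e) := by
    have h1 : ‖τ • e‖ ≤ δ / 2 := by
      rw [norm_smul, Real.norm_of_nonneg hτ0, ← hse]; gcongr
    have h2 : ‖x + τ • e‖ < δ := (norm_add_le _ _).trans_lt (by linarith)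
    refine ⟨h2, ?_⟩
    have h3 := happ' _ (hN' _ h2) _ (hN' x (by linarith))
    rw [add_sub_cancel_left, map_smul, norm_smul, Real.norm_of_nonneg hτ0, smul_eq_mul] at h3
    have h4 := (abs_le.1 h3).1
    have h5 : ε * (τ * ‖e‖) = τ * (c / 2) := by rw [← hεe]; ring
    rw [h5] at h4
    linarith
  have hdisj (x : E) (hx : ‖x‖ < δ) (hρ : 0 < ρ x) : x ∉ frontier Ω := fun h =>
    hρ.ne' (hfr' x hx h)
  -- The point `q` of `Ω` is joined to `s • e` by two segments, first along `e` and then shrinking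
  -- `q` to `0`. As `ρ` is positive on both, they avoid the frontier and stay in `Ω`.
  have hseg1 : q + s • e ∈ Ω := by
    refine (convex_segment q (q + s • e)).isPreconnected.subset_of_disjoint_frontier hΩ
      ⟨q, left_mem_segment _ _ _, hqΩ⟩ (Set.disjoint_left.2 ?_) (right_mem_segment _ _ _)
    rw [segment_eq_image']
    rintro _ ⟨θ, ⟨hθ0, hθ1⟩, rfl⟩
    have h1 := hup q hqδ (θ * s) (by positivity) (mul_le_of_le_one_left hspos.le hθ1)
    simp only [add_sub_cancel_left, smul_smul]
    refine hdisj _ h1.1 (lt_of_lt_of_le ?_ h1.2)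
    positivity
  refine ⟨s, ?_⟩
  refine (convex_segment (q + s • e) (s • e)).isPreconnected.subset_of_disjoint_frontier hΩ
      ⟨_, left_mem_segment _ _ _, hseg1⟩ (Set.disjoint_left.2 ?_) (right_mem_segment _ _ _)
  rw [segment_eq_image']
  rintro _ ⟨θ, ⟨hθ0, hθ1⟩, rfl⟩
  have h2 : q + s • e + θ • (s • e - (q + s • e)) = (1 - θ) • q + s • e := by module
  have h3 : ‖(1 - θ) • q‖ ≤ ‖q‖ := by
    rw [norm_smul, Real.norm_of_nonneg (by linarith)]
    exact mul_le_of_le_one_left (norm_nonneg _) (by linarith)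
  have h4 := hup ((1 - θ) • q) (h3.trans_lt hqδ) s hspos.le le_rfl
  simp only [h2]
  refine hdisj _ h4.1 (lt_of_lt_of_le ?_ h4.2)
  have h5 := happ' _ (hN' ((1 - θ) • q) (by linarith)) 0 (hN' 0 (by simpa using hδ))
  rw [h0, sub_zero, sub_zero] at h5
  have h6 := (abs_le.1 h5).1
  have h7 := (abs_le.1 (ℓ.le_opNorm ((1 - θ) • q))).1
  have h8 : ‖ℓ‖ * ‖(1 - θ) • q‖ ≤ ‖ℓ‖ * ‖q‖ := by gcongr
  have h9 : ε * ‖(1 - θ) • q‖ ≤ ε * ‖q‖ := by gcongr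
  linarith

/-- An open set misses its frontier, so `ρ` does not vanish on `Ω` near `0`, and one of the two
signs occurs arbitrarily close to `0`. The negative sign is treated by passing to `-ρ` and `-e`. -/
theorem exists_smul_mem_of_mem_frontier {Ω : Set E} (hΩ : IsOpen Ω) {ρ : E → ℝ} {ℓ : E →L[ℝ] ℝ}
    (hder : HasStrictFDerivAt ρ ℓ 0) (hmem : 0 ∈ frontier Ω)
    (hfr : ∀ᶠ z in 𝓝 0, z ∈ frontier Ω ↔ ρ z = 0) {e : E} (he : 0 < ℓ e) :
    ∃ s : ℝ, s • e ∈ Ω := by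
  have h0 : ρ 0 = 0 := hfr.self_of_nhds.1 hmem
  have hfreq : ∃ᶠ q in 𝓝 (0 : E), q ∈ Ω :=
    mem_closure_iff_frequently.1 (frontier_subset_closure hmem)
  have hne : ∃ᶠ q in 𝓝 (0 : E), (q ∈ Ω ∧ 0 < ρ q) ∨ (q ∈ Ω ∧ 0 < -ρ q) := by
    refine (hfreq.and_eventually hfr).mono fun q hq => ?_
    have h1 : ρ q ≠ 0 := fun h => by
      have := hq.2.2 h
      rw [hΩ.frontier_eq] at this
      exact this.2 hq.1
    rcases h1.lt_or_gt with h | h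
    · exact Or.inr ⟨hq.1, by linarith⟩
    · exact Or.inl ⟨hq.1, h⟩
  rcases Filter.frequently_or_distrib.1 hne with h | h
  · exact exists_smul_mem_of_frequently_pos hΩ hder h0 (hfr.mono fun z hz => hz.1) he h
  · obtain ⟨s, hs⟩ := exists_smul_mem_of_frequently_pos hΩ (ρ := fun z => -ρ z) (ℓ := -ℓ) (e := -e)
      hder.neg (by simp [h0]) (hfr.mono fun z hz hz' => by simp [hz.1 hz']) (by simpa using he) h
    exact ⟨-s, by simpa using hs⟩

end Sides

/-! ### Hypersurfaces parabolic to leading order -/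

section ParabolicDefiningFunction

variable {F : Type*} [NormedAddCommGroup F]

/-- Near the origin, `S` is the zero set of a continuous function which agrees with
`y - ‖x‖²` to leading order for the weights `1` of `x` and `2` of `y`. -/
structure IsParabolicDefiningFunction (S : Set (F × ℝ)) (ρ : F × ℝ → ℝ) : Prop where
  mem_iff : ∀ᶠ z in 𝓝 (0 : F × ℝ), z ∈ S ↔ ρ z = 0
  continuousAt : ∀ᶠ z in 𝓝 (0 : F × ℝ), ContinuousAt ρ z
  expansion : ∀ ε > 0, ∀ᶠ z in 𝓝 (0 : F × ℝ),
    |ρ z - (z.2 - ‖z.1‖ ^ 2)| ≤ ε * (‖z.1‖ ^ 2 + |z.2|)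

namespace IsParabolicDefiningFunction

variable {S : Set (F × ℝ)} {ρ : F × ℝ → ℝ}

theorem eventually_abs_le (h : IsParabolicDefiningFunction S ρ) {ε : ℝ} (hε : 0 < ε) :
    ∀ᶠ z in 𝓝 (0 : F × ℝ), z ∈ S → |z.2 - ‖z.1‖ ^ 2| ≤ ε * (‖z.1‖ ^ 2 + |z.2|) := by
  filter_upwards [h.mem_iff, h.expansion ε hε] with z hz1 hz2 hz
  rwa [hz1.1 hz, zero_sub, abs_neg] at hz2

/-- Over every small `x` there is a small point of `S`. -/
theorem eventually_exists_mem (h : IsParabolicDefiningFunction S ρ) :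
    ∀ᶠ x in 𝓝 (0 : F), ∃ y : ℝ, |y| ≤ 2 * ‖x‖ ^ 2 ∧ (x, y) ∈ S := by
  -- For the intermediate value theorem between heights `0` and `2‖x‖²`: at the upper end the main
  -- term is `‖x‖²` and the error is at most `ε * 3‖x‖²`, whence `ε = 1 / 3`.
  obtain ⟨δ, hδ, hball⟩ := Metric.eventually_nhds_iff_ball.1
    (h.mem_iff.and (h.continuousAt.and (h.expansion (1 / 3) (by norm_num))))
  have hsmall : ∀ᶠ x in 𝓝 (0 : F), ‖x‖ < δ ∧ 2 * ‖x‖ ^ 2 < δ :=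
    ((continuous_norm.tendsto' 0 0 norm_zero).eventually (gt_mem_nhds hδ)).and
      (((by fun_prop : Continuous fun x : F => 2 * ‖x‖ ^ 2).tendsto' 0 0 (by simp)).eventually
        (gt_mem_nhds hδ))
  filter_upwards [hsmall] with x hx
  have hmem (y : ℝ) (hy : y ∈ Icc 0 (2 * ‖x‖ ^ 2)) : (x, y) ∈ Metric.ball (0 : F × ℝ) δ := by
    rw [mem_ball_zero_iff, Prod.norm_mk, max_lt_iff, Real.norm_of_nonneg hy.1]
    exact ⟨hx.1, hy.2.trans_lt hx.2⟩
  have h0 : (0 : ℝ) ≤ 2 * ‖x‖ ^ 2 := by positivity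
  have hcont : ContinuousOn (fun y : ℝ => ρ (x, y)) (Icc 0 (2 * ‖x‖ ^ 2)) := fun y hy =>
    (ContinuousAt.comp (f := fun y : ℝ => (x, y)) (hball _ (hmem y hy)).2.1
      (by fun_prop)).continuousWithinAt
  have h1 := (abs_le.1 (hball _ (hmem 0 ⟨le_rfl, h0⟩)).2.2).2
  have h2 := (abs_le.1 (hball _ (hmem _ ⟨h0, le_rfl⟩)).2.2).1
  simp only [abs_zero, abs_of_nonneg h0] at h1 h2
  obtain ⟨y, hy, hy0⟩ := intermediate_value_Icc h0 hcont
    (show (0 : ℝ) ∈ Icc _ _ from ⟨by nlinarith, by nlinarith⟩)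
  exact ⟨y, by rw [abs_of_nonneg hy.1]; exact hy.2, (hball _ (hmem y hy)).1.2 hy0⟩

variable [InnerProductSpace ℝ F]

/-- Parabolic blow-ups of `S` at the origin lie on the paraboloid. -/
theorem eq_of_tendsto (h : IsParabolicDefiningFunction S ρ) {α : Type*} {l : Filter α} [l.NeBot]
    {s N : α → ℝ} {P : α → F} {N₀ q : ℝ} (hs : Tendsto s l (𝓝 0)) (hs0 : ∀ᶠ k in l, s k ≠ 0)
    (hP : Tendsto (fun k => ‖P k‖ ^ 2) l (𝓝 q)) (hN : Tendsto N l (𝓝 N₀))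
    (hmem : ∀ᶠ k in l, (s k • P k, s k ^ 2 * N k) ∈ S) : N₀ = q := by
  have hs2 : Tendsto (fun k => s k ^ 2) l (𝓝 0) := by simpa using hs.pow 2
  have hz : Tendsto (fun k => ((s k • P k, s k ^ 2 * N k) : F × ℝ)) l (𝓝 0) := by
    refine Tendsto.prodMk_nhds ?_ (by simpa using hs2.mul hN)
    rw [tendsto_zero_iff_norm_tendsto_zero]
    have h1 : Tendsto (fun k => √(s k ^ 2 * ‖P k‖ ^ 2)) l (𝓝 0) := by
      simpa using (hs2.mul hP).sqrt
    refine h1.congr fun k => ?_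
    rw [← mul_pow, Real.sqrt_sq_eq_abs, abs_mul, abs_norm, norm_smul, Real.norm_eq_abs]
  have key (ε : ℝ) (hε : 0 < ε) : |N₀ - q| ≤ ε * (q + |N₀|) := by
    have h1 : Tendsto (fun k => |N k - ‖P k‖ ^ 2|) l (𝓝 |N₀ - q|) := (hN.sub hP).abs
    have h2 : Tendsto (fun k => ε * (‖P k‖ ^ 2 + |N k|)) l (𝓝 (ε * (q + |N₀|))) :=
      (hP.add hN.abs).const_mul ε
    refine le_of_tendsto_of_tendsto h1 h2 ?_
    filter_upwards [hz.eventually (h.eventually_abs_le hε), hmem, hs0] with k hk1 hk2 hk3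
    have h3 := hk1 hk2
    have h4 : 0 < s k ^ 2 := by positivity
    simp only [norm_smul, mul_pow, Real.norm_eq_abs, sq_abs] at h3
    rw [← mul_sub, abs_mul, abs_mul, abs_of_pos h4, ← mul_add, mul_left_comm] at h3
    exact le_of_mul_le_mul_left h3 h4
  have h3 : Tendsto (fun ε : ℝ => ε * (q + |N₀|)) (𝓝[>] 0) (𝓝 0) := by
    refine Tendsto.mono_left (Continuous.tendsto' (by fun_prop) _ _ (by simp)) nhdsWithin_le_nhds
  have h4 : |N₀ - q| ≤ 0 := ge_of_tendsto h3 (by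
    filter_upwards [self_mem_nhdsWithin] with ε hε using key ε hε)
  exact sub_eq_zero.1 (abs_eq_zero.1 (le_antisymm h4 (abs_nonneg _)))

/-- Tangent vectors of `S` at the origin are horizontal. -/
theorem snd_eq_zero_of_tendsto (h : IsParabolicDefiningFunction S ρ) {α : Type*} {l : Filter α}
    [l.NeBot] {t : α → ℝ} {z : α → F × ℝ} {v : F × ℝ} (ht : Tendsto t l (𝓝 0))
    (ht0 : ∀ᶠ k in l, 0 < t k) (hz : Tendsto (fun k => (t k)⁻¹ • z k) l (𝓝 v))
    (hmem : ∀ᶠ k in l, z k ∈ S) : v.2 = 0 := by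
  -- Parabolic blow-up at scale `√t`: the rescaled base points tend to `0`, while the rescaled
  -- heights tend to `v.2`.
  have hs : Tendsto (fun k => √(t k)) l (𝓝 0) := by simpa using ht.sqrt
  have hP : Tendsto (fun k => √(t k) • ((t k)⁻¹ • z k).1) l (𝓝 0) := by
    simpa using hs.smul ((continuous_fst.tendsto v).comp hz)
  refine h.eq_of_tendsto (q := 0) hs ?_ ?_ ((continuous_snd.tendsto v).comp hz) (P :=
    fun k => √(t k) • ((t k)⁻¹ • z k).1) ?_
  · filter_upwards [ht0] with k hk using (Real.sqrt_pos.2 hk).ne'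
  · simpa using hP.norm.pow 2
  · filter_upwards [ht0, hmem] with k hk hk'
    have h1 : √(t k) * √(t k) = t k := Real.mul_self_sqrt hk.le
    have h2 : ((√(t k) • √(t k) • ((t k)⁻¹ • z k).1,
        √(t k) ^ 2 * (Prod.snd ∘ fun k => (t k)⁻¹ • z k) k) : F × ℝ) = z k := by
      ext
      · simp only [smul_smul, Prod.smul_fst]
        rw [← mul_assoc, h1, mul_inv_cancel₀ hk.ne', one_smul]
      · simp only [pow_two, h1, Function.comp_apply, Prod.smul_snd, smul_eq_mul]
        rw [mul_inv_cancel_left₀ hk.ne']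
    rwa [h2]

/-- The slices of `S` at small positive heights are nonempty. -/
theorem eventually_exists_mem_slice [Nontrivial F] (h : IsParabolicDefiningFunction S ρ) :
    ∀ᶠ c in 𝓝[>] (0 : ℝ), ∃ x : F, ‖x‖ ^ 2 ≤ 2 * c ∧ (x, c) ∈ S := by
  -- Intermediate value theorem at height `c` along a ray: `ρ` is positive at `x = 0` and negative
  -- at `‖x‖² = 2c`, where the error is at most `3c / 4` against a main term `-c`.
  obtain ⟨δ, hδ, hball⟩ := Metric.eventually_nhds_iff_ball.1
    (h.mem_iff.and (h.continuousAt.and (h.expansion (1 / 4) (by norm_num))))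
  obtain ⟨u, hu⟩ := exists_norm_eq F zero_le_one
  have hsmall : ∀ᶠ c in 𝓝 (0 : ℝ), c < δ ∧ √(2 * c) < δ :=
    (gt_mem_nhds hδ).and (((by fun_prop : Continuous fun c : ℝ => √(2 * c)).tendsto' 0 0
      (by simp)).eventually (gt_mem_nhds hδ))
  filter_upwards [nhdsWithin_le_nhds hsmall, self_mem_nhdsWithin] with c hc (hc0 : 0 < c)
  have hnorm (s : ℝ) (hs : s ∈ Icc 0 √(2 * c)) : ‖s • u‖ = s := by
    rw [norm_smul, hu, mul_one, Real.norm_of_nonneg hs.1]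
  have hmem (s : ℝ) (hs : s ∈ Icc 0 √(2 * c)) : (s • u, c) ∈ Metric.ball (0 : F × ℝ) δ := by
    rw [mem_ball_zero_iff, Prod.norm_mk, max_lt_iff, Real.norm_of_nonneg hc0.le, hnorm s hs]
    exact ⟨hs.2.trans_lt hc.2, hc.1⟩
  have h0 : 0 ≤ √(2 * c) := Real.sqrt_nonneg _
  have hcont : ContinuousOn (fun s : ℝ => ρ (s • u, c)) (Icc 0 √(2 * c)) := fun s hs =>
    (ContinuousAt.comp (f := fun s : ℝ => (s • u, c)) (hball _ (hmem s hs)).2.1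
      (by fun_prop)).continuousWithinAt
  have h1 := (abs_le.1 (hball _ (hmem 0 ⟨le_rfl, h0⟩)).2.2).1
  have h2 := (abs_le.1 (hball _ (hmem _ ⟨h0, le_rfl⟩)).2.2).2
  simp only [hnorm 0 ⟨le_rfl, h0⟩, hnorm _ ⟨h0, le_rfl⟩, abs_of_pos hc0,
    Real.sq_sqrt (by positivity : 0 ≤ 2 * c)] at h1 h2
  obtain ⟨s, hs, hs0⟩ := intermediate_value_Icc' h0 hcont
    (show (0 : ℝ) ∈ Icc _ _ from ⟨by nlinarith, by nlinarith⟩)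
  refine ⟨s • u, ?_, (hball _ (hmem s hs)).1.2 hs0⟩
  rw [hnorm s hs, ← Real.le_sqrt hs.1 (by positivity)]
  exact hs.2

/-- A linear symmetry of `S` acts on the tangent space at the origin by a similarity whose
squared ratio is its factor in the transversal direction. -/
theorem linear_symmetry (h : IsParabolicDefiningFunction S ρ) {g : F × ℝ →L[ℝ] F × ℝ}
    (hg : ∀ z ∈ S, g z ∈ S) (x : F) :
    (g (x, 0)).2 = 0 ∧ ‖(g (x, 0)).1‖ ^ 2 = (g (0, 1)).2 * ‖x‖ ^ 2 := by
  have hx : Tendsto (fun s : ℝ => s • x) (𝓝[>] 0) (𝓝 0) :=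
    (Continuous.tendsto' (by fun_prop) _ _ (by simp)).mono_left nhdsWithin_le_nhds
  -- Points `(s x, s² m(s))` of `S`, with `m(s) → ‖x‖²`. Their images under `g` give a tangent
  -- vector at first order and a point of the limiting paraboloid after parabolic rescaling.
  have hex : ∀ᶠ s in 𝓝[>] (0 : ℝ), ∃ m : ℝ, |m| ≤ 2 * ‖x‖ ^ 2 ∧ (s • x, s ^ 2 * m) ∈ S := by
    filter_upwards [hx.eventually h.eventually_exists_mem, self_mem_nhdsWithin] with s hs
      (hs0 : 0 < s)
    obtain ⟨y, hy, hyS⟩ := hs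
    refine ⟨y / s ^ 2, ?_, ?_⟩
    · rw [norm_smul, Real.norm_of_nonneg hs0.le, mul_pow] at hy
      rw [abs_div, abs_of_pos (by positivity : 0 < s ^ 2), div_le_iff₀ (by positivity)]
      linarith
    · rwa [mul_div_cancel₀ _ (by positivity)]
  have : ∃ m : ℝ → ℝ, ∀ᶠ s in 𝓝[>] (0 : ℝ), |m s| ≤ 2 * ‖x‖ ^ 2 ∧ (s • x, s ^ 2 * m s) ∈ S :=
    hex.choice
  obtain ⟨m, hm⟩ := this
  have hs0 : Tendsto (fun s : ℝ => s) (𝓝[>] 0) (𝓝 0) := tendsto_id.mono_left nhdsWithin_le_nhds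
  have hspos : ∀ᶠ s in 𝓝[>] (0 : ℝ), 0 < s := self_mem_nhdsWithin
  have hm0 : Tendsto m (𝓝[>] 0) (𝓝 (‖x‖ ^ 2)) := by
    rw [Metric.tendsto_nhds]
    intro η hη
    have hq : 0 < 3 * ‖x‖ ^ 2 + 1 := by positivity
    have hz : Tendsto (fun s => ((s • x, s ^ 2 * m s) : F × ℝ)) (𝓝[>] 0) (𝓝 0) := by
      refine hx.prodMk_nhds ?_
      have h1 : Tendsto (fun s : ℝ => s ^ 2 * (2 * ‖x‖ ^ 2)) (𝓝[>] 0) (𝓝 0) :=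
        (Continuous.tendsto' (by fun_prop) _ _ (by simp)).mono_left nhdsWithin_le_nhds
      refine squeeze_zero_norm' ?_ h1
      filter_upwards [hm] with s hs
      rw [norm_mul, Real.norm_of_nonneg (sq_nonneg s), Real.norm_eq_abs]
      exact mul_le_mul_of_nonneg_left hs.1 (sq_nonneg s)
    filter_upwards [hm, hz.eventually (h.eventually_abs_le (div_pos hη hq)), hspos]
      with s hs hs1 hs2
    have h1 := hs1 hs.2
    have h2 : 0 < s ^ 2 := by positivity
    simp only [norm_smul, mul_pow, Real.norm_eq_abs, sq_abs] at h1
    rw [← mul_sub, abs_mul, abs_mul, abs_of_pos h2, ← mul_add, mul_left_comm] at h1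
    have h3 := le_of_mul_le_mul_left h1 h2
    rw [Real.dist_eq]
    calc |m s - ‖x‖ ^ 2| ≤ η / (3 * ‖x‖ ^ 2 + 1) * (‖x‖ ^ 2 + |m s|) := h3
      _ ≤ η / (3 * ‖x‖ ^ 2 + 1) * (‖x‖ ^ 2 + 2 * ‖x‖ ^ 2) := by gcongr; exact hs.1
      _ < η / (3 * ‖x‖ ^ 2 + 1) * (3 * ‖x‖ ^ 2 + 1) := 
          mul_lt_mul_of_pos_left (by linarith) (by positivity)
      _ = η := div_mul_cancel₀ _ hq.ne'
  have hsm : Tendsto (fun s => s * m s) (𝓝[>] 0) (𝓝 0) := by simpa using hs0.mul hm0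
  have hgz (s : ℝ) : g (s • x, s ^ 2 * m s) = s • (g (x, 0) + (s * m s) • g (0, 1)) := by
    rw [← map_smul, ← map_add, ← map_smul]
    congr 1
    ext <;> simp; ring
  have hlim : Tendsto (fun s => g (x, 0) + (s * m s) • g (0, 1)) (𝓝[>] 0) (𝓝 (g (x, 0))) := by
    simpa using (hsm.smul_const (g (0, 1))).const_add (g (x, 0))
  have h0 : (g (x, 0)).2 = 0 := by
    refine h.snd_eq_zero_of_tendsto hs0 hspos (z := fun s => g (s • x, s ^ 2 * m s)) ?_
      (hm.mono fun s hs => hg _ hs.2)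
    refine hlim.congr' ?_
    filter_upwards [hspos] with s hs
    rw [hgz, inv_smul_smul₀ hs.ne']
  refine ⟨h0, (h.eq_of_tendsto (s := fun s : ℝ => s) (N := fun s => m s * (g (0, 1)).2)
    (P := fun s => (g (x, 0) + (s * m s) • g (0, 1)).1) hs0 (hspos.mono fun s hs => hs.ne')
    (((continuous_fst.norm.pow 2).tendsto _).comp hlim) (hm0.mul_const _) ?_).symm.trans
    (mul_comm _ _)⟩
  filter_upwards [hm] with s hs
  have h1 := hg _ hs.2
  rw [hgz] at h1
  convert h1 using 1
  ext
  · simp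
  · simp [h0]; ring

/-- Shears along the transversal direction preserve the leading order of the expansion. -/
theorem shear (h : IsParabolicDefiningFunction S ρ) (b : F) :
    IsParabolicDefiningFunction {z : F × ℝ | (z.1 + z.2 • b, z.2) ∈ S}
      (fun z => ρ (z.1 + z.2 • b, z.2)) := by
  have hcont : Continuous fun z : F × ℝ => ((z.1 + z.2 • b, z.2) : F × ℝ) := by fun_prop
  have ht : Tendsto (fun z : F × ℝ => ((z.1 + z.2 • b, z.2) : F × ℝ)) (𝓝 0) (𝓝 0) :=
    hcont.tendsto' _ _ (by simp)
  refine ⟨ht.eventually h.mem_iff, (ht.eventually h.continuousAt).mono fun z hz =>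
    ContinuousAt.comp (f := fun z : F × ℝ => ((z.1 + z.2 • b, z.2) : F × ℝ)) hz hcont.continuousAt,
    fun ε hε => ?_⟩
  have hsmall : ∀ᶠ z in 𝓝 (0 : F × ℝ), 2 * ‖z.1‖ * ‖b‖ + |z.2| * ‖b‖ ^ 2 < min 1 (ε / 4) :=
    ((by fun_prop : Continuous fun z : F × ℝ => 2 * ‖z.1‖ * ‖b‖ + |z.2| * ‖b‖ ^ 2).tendsto' 0 0
      (by simp)).eventually (gt_mem_nhds (by positivity))
  filter_upwards [ht.eventually (h.expansion (ε / 4) (by positivity)), hsmall] with z hz1 hz2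
  obtain ⟨h1, h2⟩ := lt_min_iff.1 hz2
  -- The shear changes `‖z.1‖²` by `|z.2|` times a quantity tending to zero, which the weighted
  -- error absorbs.
  have h3 : |‖z.1 + z.2 • b‖ ^ 2 - ‖z.1‖ ^ 2| ≤
      |z.2| * (2 * ‖z.1‖ * ‖b‖ + |z.2| * ‖b‖ ^ 2) := by
    rw [norm_add_sq_real, norm_smul, Real.norm_eq_abs, inner_smul_right]
    have h4 := abs_real_inner_le_norm z.1 b
    have h5 : |2 * (z.2 * inner ℝ z.1 b)| ≤ |z.2| * (2 * (‖z.1‖ * ‖b‖)) := by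
      rw [abs_mul, abs_mul, abs_two, mul_left_comm]; gcongr
    have h6 : |(|z.2| * ‖b‖) ^ 2| = (|z.2| * ‖b‖) ^ 2 := abs_of_nonneg (sq_nonneg _)
    calc |‖z.1‖ ^ 2 + 2 * (z.2 * inner ℝ z.1 b) + (|z.2| * ‖b‖) ^ 2 - ‖z.1‖ ^ 2|
        = |2 * (z.2 * inner ℝ z.1 b) + (|z.2| * ‖b‖) ^ 2| := by congr 1; ring
      _ ≤ |2 * (z.2 * inner ℝ z.1 b)| + |(|z.2| * ‖b‖) ^ 2| := abs_add_le _ _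
      _ ≤ |z.2| * (2 * (‖z.1‖ * ‖b‖)) + (|z.2| * ‖b‖) ^ 2 := by rw [h6]; gcongr
      _ = _ := by ring
  have h4 : |z.2| * (2 * ‖z.1‖ * ‖b‖ + |z.2| * ‖b‖ ^ 2) ≤ |z.2| * (ε / 4) := by gcongr
  have h5 : |z.2| * (2 * ‖z.1‖ * ‖b‖ + |z.2| * ‖b‖ ^ 2) ≤ |z.2| * 1 := by gcongr
  have h6 : ‖z.1 + z.2 • b‖ ^ 2 ≤ ‖z.1‖ ^ 2 + |z.2| := by
    have := (abs_le.1 h3).2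
    linarith
  have h7 : ε / 4 * (‖z.1 + z.2 • b‖ ^ 2 + |z.2|) ≤ ε / 4 * ((‖z.1‖ ^ 2 + |z.2|) + |z.2|) := by
    gcongr
  have h8 : 0 ≤ ε * ‖z.1‖ ^ 2 := by positivity
  have h9 : 0 ≤ ε * |z.2| := by positivity
  rw [abs_le] at hz1 h3 ⊢
  constructor <;> nlinarith

/-- A set with a parabolic defining function that is invariant under a quasi-homogeneous
contraction is a paraboloid. -/
theorem eq_paraboloid_of_contraction (h : IsParabolicDefiningFunction S ρ) {L : F → F} {χ : ℝ}
    (hχ0 : 0 < χ) (hχ1 : χ < 1) (hL : ∀ x, ‖L x‖ ^ 2 = χ * ‖x‖ ^ 2)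
    (hS : ∀ x y, (L x, χ * y) ∈ S ↔ (x, y) ∈ S) : S = {z | z.2 = ‖z.1‖ ^ 2} := by
  have hLk (x : F) (k : ℕ) : ‖L^[k] x‖ ^ 2 = χ ^ k * ‖x‖ ^ 2 := by
    induction k with
    | zero => simp
    | succ k ih => rw [Function.iterate_succ_apply', hL, ih, pow_succ]; ring
  have hSk (x : F) (y : ℝ) (k : ℕ) : (L^[k] x, χ ^ k * y) ∈ S ↔ (x, y) ∈ S := by
    induction k with
    | zero => simp
    | succ k ih => rw [Function.iterate_succ_apply', pow_succ', mul_assoc, hS, ih]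
  have hpow : Tendsto (fun k : ℕ => χ ^ k) atTop (𝓝 0) :=
    tendsto_pow_atTop_nhds_zero_of_lt_one hχ0.le hχ1
  -- Rescaled parabolically by `√(χ ^ k)`, the iterates of `(x, y)` keep the same height `y` and the
  -- same norm `‖x‖`, so the blow-up limit gives the equation exactly.
  have hsub (x : F) (y : ℝ) (hxy : (x, y) ∈ S) : y = ‖x‖ ^ 2 := by
    refine h.eq_of_tendsto (l := atTop) (s := fun k : ℕ => √(χ ^ k)) (N := fun _ => y)
      (P := fun k => (√(χ ^ k))⁻¹ • L^[k] x) (by simpa using hpow.sqrt)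
      (Eventually.of_forall fun k => by positivity) ?_ tendsto_const_nhds
      (Eventually.of_forall fun k => ?_)
    · refine tendsto_const_nhds.congr fun k => ?_
      rw [norm_smul, mul_pow, hLk, norm_inv, inv_pow, Real.norm_of_nonneg (Real.sqrt_nonneg _),
        Real.sq_sqrt (by positivity), inv_mul_cancel_left₀ (by positivity)]
    · rw [smul_inv_smul₀ (by positivity), Real.sq_sqrt (by positivity)]
      exact (hSk x y k).2 hxy
  ext ⟨x, y⟩
  refine ⟨hsub x y, ?_⟩
  rintro (rfl : y = ‖x‖ ^ 2)
  have hx : Tendsto (fun k => L^[k] x) atTop (𝓝 0) := by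
    rw [tendsto_zero_iff_norm_tendsto_zero]
    have h1 : Tendsto (fun k : ℕ => √(χ ^ k * ‖x‖ ^ 2)) atTop (𝓝 0) := by
      have := (hpow.mul_const (‖x‖ ^ 2)).sqrt
      rwa [zero_mul, Real.sqrt_zero] at this
    refine h1.congr fun k => ?_
    rw [← hLk, Real.sqrt_sq (norm_nonneg _)]
  -- Over a sufficiently contracted iterate of `x` there is a point of `S`; pulled back it lies over
  -- `x`, and the first inclusion determines its height.
  obtain ⟨k, y', -, hy'⟩ := (hx.eventually h.eventually_exists_mem).exists
  have h1 : (x, y' / χ ^ k) ∈ S := by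
    rw [← hSk x _ k, mul_div_cancel₀ _ (by positivity)]
    exact hy'
  rwa [hsub _ _ h1] at h1

end IsParabolicDefiningFunction

end ParabolicDefiningFunction

/-! ### Isotropy of a boundary point: the dimension count -/

section Isotropy

variable {E : Type*} [NormedAddCommGroup E] [NormedSpace ℝ E]

/-- The affine symmetries of `Ω` that fix the origin are linear symmetries of the boundary. -/
theorem exists_continuousLinearEquiv_of_fixes_zero {Ω : Set E} (hΩ : IsOpen Ω) (hne : Ω.Nonempty)
    {u : (E × ℝ →L[ℝ] E × ℝ)ˣ} (hu : u ∈ linearizedSymmetryGroup Ω)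
    (hu0 : (u : E × ℝ →L[ℝ] E × ℝ) (0, 1) = (0, 1)) :
    ∃ g : E ≃L[ℝ] E, (∀ z, (u : E × ℝ →L[ℝ] E × ℝ) (z, 1) = (g z, 1)) ∧
      ∀ z, g z ∈ frontier Ω ↔ z ∈ frontier Ω := by
  let g (u : (E × ℝ →L[ℝ] E × ℝ)ˣ) : E →L[ℝ] E :=
    (ContinuousLinearMap.fst ℝ E ℝ).comp
      ((u : E × ℝ →L[ℝ] E × ℝ).comp (ContinuousLinearMap.inl ℝ E ℝ))
  have hsnd {u : (E × ℝ →L[ℝ] E × ℝ)ˣ} (hu : u ∈ linearizedSymmetryGroup Ω) (z : E) :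
      (u : E × ℝ →L[ℝ] E × ℝ) (z, 0) = (g u z, 0) :=
    Prod.ext rfl (snd_apply_of_mem_linearizedSymmetryGroup hΩ hne hu _)
  have hinv : (u * u⁻¹ : (E × ℝ →L[ℝ] E × ℝ)ˣ) = 1 := mul_inv_cancel u
  have hinv' : (u⁻¹ * u : (E × ℝ →L[ℝ] E × ℝ)ˣ) = 1 := inv_mul_cancel u
  have hl (z : E) : g u⁻¹ (g u z) = z := by
    have h1 : (u⁻¹ : (E × ℝ →L[ℝ] E × ℝ)ˣ).val (u.val (z, 0)) = (z, 0) :=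
      congrArg (fun u : (E × ℝ →L[ℝ] E × ℝ)ˣ => u.val (z, 0)) hinv'
    rw [hsnd hu, hsnd (inv_mem hu)] at h1
    exact congrArg Prod.fst h1
  have hr (z : E) : g u (g u⁻¹ z) = z := by
    have h1 : u.val ((u⁻¹ : (E × ℝ →L[ℝ] E × ℝ)ˣ).val (z, 0)) = (z, 0) :=
      congrArg (fun u : (E × ℝ →L[ℝ] E × ℝ)ˣ => u.val (z, 0)) hinv
    rw [hsnd (inv_mem hu), hsnd hu] at h1
    exact congrArg Prod.fst h1
  have hval (z : E) : (u : E × ℝ →L[ℝ] E × ℝ) (z, 1) = (g u z, 1) := by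
    have h1 : ((z, 1) : E × ℝ) = (z, 0) + (0, 1) := by simp
    rw [h1, map_add, hu0, hsnd hu]
    simp
  refine ⟨ContinuousLinearEquiv.equivOfInverse (g u) (g u⁻¹) hl hr, hval, fun z => ?_⟩
  have h1 := mem_unitSlice_frontier_iff hΩ hu (z, 1)
  rw [hval] at h1
  simpa [unitSlice] using h1

theorem snd_apply_of_mem_lieSubmodule [CompleteSpace E] {Ω : Set E} (hΩ : IsOpen Ω)
    (hne : Ω.Nonempty) (hG : IsClosed (linearizedSymmetryGroup Ω : Set (E × ℝ →L[ℝ] E × ℝ)ˣ))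
    {X : E × ℝ →L[ℝ] E × ℝ} (hX : X ∈ lieSubmodule (linearizedSymmetryGroup Ω) hG) (v : E × ℝ) :
    (X v).2 = 0 := by
  have h1 := (ContinuousLinearMap.snd ℝ E ℝ).hasFDerivAt.comp_hasDerivAt (0 : ℝ)
    (hasDerivAt_exp_apply X v)
  have h2 : (ContinuousLinearMap.snd ℝ E ℝ ∘ fun t : ℝ => NormedSpace.exp (t • X) v) =
      fun _ => v.2 := by
    ext t
    exact snd_apply_of_mem_linearizedSymmetryGroup hΩ hne (hX t) v
  rw [h2] at h1
  exact h1.unique (hasDerivAt_const _ _)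

/-- The isotropy group of a boundary point of an affinely homogeneous open set moves every interior
point if the boundary has a tangent space of positive codimension there. -/
theorem exists_one_parameter_group_moving [FiniteDimensional ℝ E] {Ω : Set E} (hΩ : IsOpen Ω)
    (htrans : ∀ x ∈ Ω, ∀ y ∈ Ω, ∃ g : E ≃ᵃ[ℝ] E, g '' Ω = Ω ∧ g x = y) (hmem : 0 ∈ frontier Ω)
    {W : Submodule ℝ E} (hW : Module.finrank ℝ W < Module.finrank ℝ E)
    (htan : ∀ (γ : ℝ → E) (v : E), HasDerivAt γ v 0 → γ 0 = 0 → (∀ t, γ t ∈ frontier Ω) → v ∈ W)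
    {x : E} (hx : x ∈ Ω) :
    ∃ g : ℝ → E ≃L[ℝ] E, (∀ z, Continuous fun t => g t z) ∧ (∀ z, g 0 z = z) ∧
      (∀ t z, g t (g (-t) z) = z) ∧ (∀ t z, g t z ∈ frontier Ω ↔ z ∈ frontier Ω) ∧
      ¬ ∀ t, g t x = x := by
  by_contra hcon
  have hne : Ω.Nonempty := ⟨x, hx⟩
  have hG := isClosed_linearizedSymmetryGroup hΩ
  have : CompleteSpace E := FiniteDimensional.complete ℝ E
  have htrans' : ∀ x ∈ Ω, ∀ y ∈ Ω, ∃ u ∈ linearizedSymmetryGroup Ω,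
      (u : E × ℝ →L[ℝ] E × ℝ) (x, 1) = (y, 1) := by
    intro x hx y hy
    obtain ⟨g, hg, hgx⟩ := htrans x hx y hy
    obtain ⟨u, hu⟩ := g.exists_linearization
    have hu1 (z : E) : g.linear z + g 0 = g z := by simpa using (g.map_vadd 0 z).symm
    refine ⟨u, mem_linearizedSymmetryGroup.2 fun v => ?_, ?_⟩
    · rw [hu]
      refine and_congr_left fun (hv : v.2 = 1) => ?_
      simp only [hv, one_smul, hu1]
      nth_rewrite 1 [← hg]
      exact g.injective.mem_set_image
    · rw [hu]
      simp only [one_smul, hu1, hgx]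
  set T := lieSubmodule (linearizedSymmetryGroup Ω) hG with hT
  have hker (X : E × ℝ →L[ℝ] E × ℝ) (hX : X ∈ T) (hX0 : X (0, 1) = 0) : X (x, 1) = 0 := by
    have hu0 (t : ℝ) : (expUnit (t • X) : E × ℝ →L[ℝ] E × ℝ) (0, 1) = (0, 1) :=
      exp_apply_of_apply_eq_zero (by simp [hX0])
    choose g hg hgS using fun t => exists_continuousLinearEquiv_of_fixes_zero hΩ hne (hX t) (hu0 t)
    have hgv (t : ℝ) (z : E) :
        g t z = ((expUnit (t • X) : E × ℝ →L[ℝ] E × ℝ) (z, 1)).1 := by rw [hg]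
    have hgx : ∀ t, g t x = x := by
      by_contra hmove
      refine hcon ⟨g, fun z => ?_, fun z => ?_, fun t z => ?_, hgS, hmove⟩
      · simp only [hgv]
        have h1 : Continuous fun t : ℝ => (expUnit (t • X) : E × ℝ →L[ℝ] E × ℝ) :=
          Units.continuous_val.comp (continuous_expUnit.comp (by fun_prop))
        exact continuous_fst.comp (h1.clm_apply continuous_const)
      · rw [hgv, zero_smul, expUnit_zero]; rfl
      · rw [hgv, ← hg]
        have h1 : expUnit (t • X) * expUnit ((-t) • X) = 1 := by
          rw [← expUnit_add_smul, add_neg_cancel, zero_smul, expUnit_zero]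
        exact congrArg (fun u : (E × ℝ →L[ℝ] E × ℝ)ˣ => (u.val (z, 1)).1) h1
    have h1 : (fun t : ℝ => NormedSpace.exp (t • X) (x, 1)) = fun _ => (x, 1) := by
      ext1 t
      exact (hg t x).trans (by rw [hgx])
    have h2 := hasDerivAt_exp_apply X (x, 1)
    rw [h1] at h2
    exact h2.unique (hasDerivAt_const _ _)
  have htan' (X : E × ℝ →L[ℝ] E × ℝ) (hX : X ∈ T) : ∃ w ∈ W, X (0, 1) = (w, 0) := by
    refine ⟨(X (0, 1)).1, ?_, Prod.ext rfl (snd_apply_of_mem_lieSubmodule hΩ hne hG hX _)⟩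
    refine htan _ _ ((ContinuousLinearMap.fst ℝ E ℝ).hasFDerivAt.comp_hasDerivAt (0 : ℝ)
      (hasDerivAt_exp_apply X (0, 1))) ?_ fun t => ?_
    · simp
    · exact ((mem_unitSlice_frontier_iff hΩ (hX t) (0, 1)).2 ⟨hmem, rfl⟩).1
  let ev (v : E × ℝ) : T →ₗ[ℝ] E × ℝ :=
    ((ContinuousLinearMap.apply ℝ (E × ℝ) v :
      (E × ℝ →L[ℝ] E × ℝ) →L[ℝ] E × ℝ) : _ →ₗ[ℝ] _) ∘ₗ T.subtype
  -- Without a group moving `x`, the isotropy algebra of the origin lies in that of `x`. This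
  -- contradicts rank-nullity, as evaluation has rank at most `dim W` at the origin and at least
  -- `dim E` at `x`.
  have hle : LinearMap.ker (ev (0, 1)) ≤ LinearMap.ker (ev (x, 1)) := fun X hX => by
    exact hker X X.2 hX
  have hrange0 : LinearMap.range (ev (0, 1)) ≤
      LinearMap.range (LinearMap.inl ℝ E ℝ ∘ₗ W.subtype) := by
    rintro _ ⟨X, rfl⟩
    obtain ⟨w, hwW, hw⟩ := htan' X X.2
    exact ⟨⟨w, hwW⟩, hw.symm⟩
  have hrange1 : LinearMap.range (LinearMap.inl ℝ E ℝ) ≤ LinearMap.range (ev (x, 1)) := by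
    rintro _ ⟨w, rfl⟩
    obtain ⟨X, hX, hXw⟩ := exists_mem_lieSubmodule_linearizedSymmetryGroup hΩ htrans' hG hx w
    exact ⟨⟨X, hX⟩, hXw⟩
  have h1 := Submodule.finrank_mono hle
  have h2 := Submodule.finrank_mono hrange0
  have h3 := Submodule.finrank_mono hrange1
  have hinj : Function.Injective (LinearMap.inl ℝ E ℝ ∘ₗ W.subtype) :=
    LinearMap.inl_injective.comp W.injective_subtype
  rw [LinearMap.finrank_range_of_inj hinj] at h2
  rw [LinearMap.finrank_range_of_inj LinearMap.inl_injective] at h3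
  have h4 := (ev (0, 1)).finrank_range_add_finrank_ker
  have h5 := (ev (x, 1)).finrank_range_add_finrank_ker
  omega

end Isotropy

/-! ### Contraction or common fixed point -/

section Paraboloid

variable {F : Type*} [NormedAddCommGroup F] [InnerProductSpace ℝ F] [FiniteDimensional ℝ F]
  {S : Set (F × ℝ)} {ρ : F × ℝ → ℝ}

namespace IsParabolicDefiningFunction

/-- If some linear symmetry of `S` contracts the transversal direction, then `S` is a
paraboloid. -/
theorem eq_paraboloid_of_linear_contraction (h : IsParabolicDefiningFunction S ρ)
    {g : F × ℝ →L[ℝ] F × ℝ} (hg : ∀ z, g z ∈ S ↔ z ∈ S) (hpos : 0 < (g (0, 1)).2)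
    (hlt : (g (0, 1)).2 < 1) : ∃ b : F, S = {z | z.2 = ‖z.1 - z.2 • b‖ ^ 2} := by
  set χ := (g (0, 1)).2 with hχ
  have hsym := h.linear_symmetry fun z hz => (hg z).2 hz
  let L : F →ₗ[ℝ] F := LinearMap.fst ℝ F ℝ ∘ₗ (g : F × ℝ →ₗ[ℝ] F × ℝ) ∘ₗ LinearMap.inl ℝ F ℝ
  have hL (x : F) : L x = (g (x, 0)).1 := rfl
  have hLnorm (x : F) : ‖L x‖ ^ 2 = χ * ‖x‖ ^ 2 := (hsym x).2
  -- `L` multiplies norms by `√χ ≠ χ`, so `χ` is not an eigenvalue of `L`. Hence `b` can be chosen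
  -- with `(b, 1)` an eigenvector of `g`, and the shear by `b` makes `g` block diagonal.
  have hinj : Function.Injective (χ • LinearMap.id - L : F →ₗ[ℝ] F) := by
    rw [injective_iff_map_eq_zero]
    intro x hx
    have h1 : L x = χ • x := by
      rw [LinearMap.sub_apply, sub_eq_zero] at hx
      exact hx.symm
    have h2 := hLnorm x
    rw [h1, norm_smul, mul_pow, Real.norm_of_nonneg hpos.le] at h2
    have h3 : (χ * (1 - χ)) * ‖x‖ ^ 2 = 0 := by linarith
    have h4 : χ * (1 - χ) ≠ 0 := mul_ne_zero hpos.ne' (by linarith)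
    simpa [h4] using h3
  obtain ⟨b, hb⟩ := LinearMap.injective_iff_surjective.1 hinj (g (0, 1)).1
  have hb' : L b + (g (0, 1)).1 = χ • b := by
    rw [← hb]; simp
  have hgz (x : F) (y : ℝ) : g (x + y • b, y) = (L x + (χ * y) • b, χ * y) := by
    have h1 : ((x + y • b, y) : F × ℝ) = (x, 0) + y • ((b, 0) + (0, 1)) := by ext <;> simp
    rw [h1, map_add, map_smul, map_add]
    ext
    · simp only [Prod.fst_add, Prod.smul_fst, ← hL, hb', smul_smul, mul_comm]
    · simp [(hsym x).1, (hsym b).1, ← hχ, mul_comm]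
  have hS := (h.shear b).eq_paraboloid_of_contraction hpos hlt hLnorm (fun x y => by
    have := hg (x + y • b, y)
    rw [hgz] at this
    exact this)
  refine ⟨b, ?_⟩
  ext ⟨x, y⟩
  have h1 := Set.ext_iff.1 hS (x - y • b, y)
  simpa using h1

/-- The factor is positive because `g` does not kill a nonzero tangent vector, and `g` and its
inverse have reciprocal factors, so one of them contracts. -/
theorem eq_paraboloid_of_linear_symmetry [Nontrivial F] (h : IsParabolicDefiningFunction S ρ)
    (g : (F × ℝ) ≃L[ℝ] (F × ℝ)) (hg : ∀ z, g z ∈ S ↔ z ∈ S) (hne : (g (0, 1)).2 ≠ 1) :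
    ∃ b : F, S = {z | z.2 = ‖z.1 - z.2 • b‖ ^ 2} := by
  have hg' (z : F × ℝ) : g.symm z ∈ S ↔ z ∈ S := by
    rw [← hg, g.apply_symm_apply]
  have hsym := h.linear_symmetry (g := g) fun z hz => (hg z).2 hz
  have hsym' := h.linear_symmetry (g := g.symm) fun z hz => (hg' z).2 hz
  simp only [ContinuousLinearEquiv.coe_coe] at hsym hsym'
  obtain ⟨x, hx⟩ := exists_ne (0 : F)
  have hpos : 0 < (g (0, 1)).2 := by
    by_contra hcon
    have h1 := (hsym x).2
    have h2 : ‖(g (x, 0)).1‖ ^ 2 ≤ 0 := by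
      rw [h1]; exact mul_nonpos_of_nonpos_of_nonneg (not_lt.1 hcon) (sq_nonneg _)
    have h3 : (g (x, 0)).1 = 0 := by
      rw [← norm_eq_zero, ← pow_eq_zero_iff two_ne_zero]
      exact le_antisymm h2 (sq_nonneg _)
    have h4 : g (x, 0) = 0 := Prod.ext h3 (hsym x).1
    rw [map_eq_zero_iff g g.injective] at h4
    exact hx (congrArg Prod.fst h4)
  have hmul : (g.symm (0, 1)).2 * (g (0, 1)).2 = 1 := by
    have h1 : g (0, 1) = ((g (0, 1)).1, 0) + (g (0, 1)).2 • (0, 1) := by ext <;> simp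
    have h2 := congrArg Prod.snd (g.symm_apply_apply (0, 1))
    rw [h1, map_add, map_smul, Prod.snd_add, (hsym' _).1, zero_add, Prod.smul_snd, smul_eq_mul,
      mul_comm] at h2
    exact h2
  rcases hne.lt_or_gt with h1 | h1
  · exact h.eq_paraboloid_of_linear_contraction (g := g) hg hpos h1
  · have h2 : 0 < (g.symm (0, 1)).2 := pos_of_mul_pos_left (by rw [hmul]; exact one_pos) hpos.le
    refine h.eq_paraboloid_of_linear_contraction (g := g.symm) hg' h2 ?_
    by_contra hcon
    have h3 := not_lt.1 hcon
    simp only [ContinuousLinearEquiv.coe_coe] at h3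
    nlinarith

/-- If a family of linear one-parameter groups of symmetries of `S` acts trivially on the
transversal direction, it has a common fixed point off the tangent space. -/
theorem exists_common_fixed_point [Nontrivial F] (h : IsParabolicDefiningFunction S ρ) :
    ∃ e : F × ℝ, 0 < e.2 ∧ ∀ g : ℝ → (F × ℝ) ≃L[ℝ] (F × ℝ), (∀ z, Continuous fun t => g t z) →
      (∀ z, g 0 z = z) → (∀ t z, g t (g (-t) z) = z) → (∀ t z, g t z ∈ S ↔ z ∈ S) →
      (∀ t, (g t (0, 1)).2 = 1) → ∀ t, g t e = e := by
  obtain ⟨δ, hδ, hball⟩ := Metric.eventually_nhds_iff_ball.1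
    (h.eventually_abs_le (by norm_num : (0 : ℝ) < 1 / 3))
  have hsmall : ∀ᶠ c in 𝓝 (0 : ℝ), c < δ ∧ 2 * c < (δ / 2) ^ 2 :=
    (gt_mem_nhds hδ).and (((by fun_prop : Continuous fun c : ℝ => 2 * c).tendsto' 0 0
      (by simp)).eventually (gt_mem_nhds (by positivity)))
  obtain ⟨c, ⟨⟨x₀, hx₀, hx₀S⟩, hc⟩, hc0, hc1⟩ := ((h.eventually_exists_mem_slice.and
    self_mem_nhdsWithin).and (nhdsWithin_le_nhds hsmall)).exists
  have hc : 0 < c := hc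
  set r := δ / 2 with hr
  have hr0 : 0 < r := by positivity
  have hlt (x : F) (hx : ‖x‖ ≤ r) (hxS : (x, c) ∈ S) : ‖x‖ < r := by
    have h1 : (x, c) ∈ Metric.ball (0 : F × ℝ) δ := by
      rw [mem_ball_zero_iff, Prod.norm_mk, max_lt_iff, Real.norm_of_nonneg hc.le]
      exact ⟨by linarith, hc0⟩
    have h2 := (abs_le.1 (hball _ h1 hxS)).1
    simp only [abs_of_pos hc] at h2
    exact lt_of_pow_lt_pow_left₀ 2 hr0.le (by linarith)
  set K : Set F := {x | (x, c) ∈ S ∧ ‖x‖ ≤ r} with hK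
  have hx₀K : x₀ ∈ K := ⟨hx₀S, by
    refine le_of_sq_le_sq ?_ hr0.le
    linarith⟩
  have hKb : Bornology.IsBounded K :=
    Metric.isBounded_closedBall.subset fun x hx => mem_closedBall_zero_iff.2 hx.2
  -- The centre depends on `K` alone, so it serves all the groups at once.
  obtain ⟨b, hb⟩ := exists_fixed_point_of_isometry hKb ⟨x₀, hx₀K⟩
  refine ⟨(b, c), hc, fun g hgc hg0 hginv hgS hg1 t => ?_⟩
  have hsym (t : ℝ) := h.linear_symmetry (g := g t) fun z hz => (hgS t z).2 hz
  simp only [ContinuousLinearEquiv.coe_coe, hg1, one_mul] at hsym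
  have hgx (t : ℝ) (x : F) : g t (x, c) = ((g t (x, c)).1, c) := by
    refine Prod.ext rfl ?_
    have h1 : ((x, c) : F × ℝ) = (x, 0) + c • (0, 1) := by ext <;> simp
    rw [h1, map_add, map_smul, Prod.snd_add, (hsym t x).1, Prod.smul_snd, hg1]
    simp
  have hKK (t : ℝ) (x : F) (hx : x ∈ K) : (g t (x, c)).1 ∈ K := by
    have hmem (t : ℝ) : ((g t (x, c)).1, c) ∈ S := by
      rw [← hgx]; exact (hgS _ _).2 hx.1
    have hcont : Continuous fun t => ‖(g t (x, c)).1‖ := (continuous_fst.comp (hgc _)).norm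
    have heq : {t | ‖(g t (x, c)).1‖ ≤ r} = {t | ‖(g t (x, c)).1‖ < r} :=
      Set.ext fun t => ⟨fun ht => hlt _ ht (hmem t), fun ht => by
        change ‖(g t (x, c)).1‖ < r at ht
        exact ht.le⟩
    -- A continuous orbit in `S` cannot cross the empty shell `‖x‖ = r`. Connectedness of the time
    -- line is what keeps it inside `K`.
    have hclopen : IsClopen {t | ‖(g t (x, c)).1‖ ≤ r} :=
      ⟨isClosed_le hcont continuous_const, heq ▸ isOpen_lt hcont continuous_const⟩
    have huniv := hclopen.eq_univ ⟨0, by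
      change ‖(g 0 (x, c)).1‖ ≤ r
      rw [hg0]; exact hx.2⟩
    exact ⟨hmem t, huniv.ge (mem_univ t)⟩
  have hfix := hb (fun x => (g t (x, c)).1) ?_ ?_
  · rw [hgx, hfix]
  · refine Isometry.of_dist_eq fun x y => ?_
    have h1 : (g t (x, c)).1 - (g t (y, c)).1 = (g t (x - y, 0)).1 := by
      rw [← Prod.fst_sub, ← map_sub]; simp
    rw [dist_eq_norm, dist_eq_norm, h1]
    have h2 := (hsym t (x - y)).2
    exact (sq_eq_sq₀ (norm_nonneg _) (norm_nonneg _)).1 h2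
  · intro x hx
    refine ⟨(g (-t) (x, c)).1, hKK _ _ hx, ?_⟩
    simp only
    rw [← hgx, hginv]

end IsParabolicDefiningFunction

/-- The boundary of an affinely homogeneous open set with a definite boundary point is a
paraboloid; here in coordinates adapted to that point. -/
theorem frontier_eq_paraboloid [Nontrivial F] {Ω : Set (F × ℝ)} (hΩ : IsOpen Ω)
    (htrans : ∀ x ∈ Ω, ∀ y ∈ Ω, ∃ g : (F × ℝ) ≃ᵃ[ℝ] (F × ℝ), g '' Ω = Ω ∧ g x = y)
    (hmem : 0 ∈ frontier Ω) (h : IsParabolicDefiningFunction (frontier Ω) ρ)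
    (hder : HasStrictFDerivAt ρ (ContinuousLinearMap.snd ℝ F ℝ) 0) :
    ∃ b : F, frontier Ω = {z | z.2 = ‖z.1 - z.2 • b‖ ^ 2} := by
  obtain ⟨e, he, hfix⟩ := h.exists_common_fixed_point
  obtain ⟨s, hs⟩ := exists_smul_mem_of_mem_frontier hΩ hder hmem h.mem_iff (e := e) he
  have hdim : Module.finrank ℝ (LinearMap.range (LinearMap.inl ℝ F ℝ)) <
      Module.finrank ℝ (F × ℝ) := by
    rw [LinearMap.finrank_range_of_inj LinearMap.inl_injective, Module.finrank_prod,
      Module.finrank_self]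
    exact Nat.lt_succ_self _
  have htan (γ : ℝ → F × ℝ) (v : F × ℝ) (hγ : HasDerivAt γ v 0) (hγ0 : γ 0 = 0)
      (hγS : ∀ t, γ t ∈ frontier Ω) : v ∈ LinearMap.range (LinearMap.inl ℝ F ℝ) := by
    refine ⟨v.1, Prod.ext rfl (Eq.symm ?_)⟩
    have h2 := hγ.tendsto_slope_zero_right
    simp only [zero_add, hγ0, sub_zero] at h2
    exact h.snd_eq_zero_of_tendsto (l := 𝓝[>] (0 : ℝ)) (t := fun t => t) (z := γ)
      (tendsto_id.mono_left nhdsWithin_le_nhds) self_mem_nhdsWithin h2 (Eventually.of_forall hγS)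
  obtain ⟨g, hgc, hg0, hginv, hgS, hmove⟩ :=
    exists_one_parameter_group_moving hΩ htrans hmem hdim htan hs
  -- If the boundary were not such a paraboloid, every transversal factor would be `1`, and the
  -- point `s • e` of `Ω` would be fixed by the group chosen to move it.
  by_contra hcon
  refine hmove fun t => ?_
  have hχ (t : ℝ) : (g t (0, 1)).2 = 1 := by
    by_contra hχ
    exact hcon (h.eq_paraboloid_of_linear_symmetry (g t) (hgS t) hχ)
  rw [map_smul, hfix g hgc hg0 hginv hgS hχ t]

end Paraboloid

/-! ### Quadratic forms and second-order expansion -/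

/-- A positive definite symmetric bilinear form is the standard one in suitable coordinates. -/
theorem exists_linearEquiv_norm_sq_eq {U : Type*} [AddCommGroup U] [Module ℝ U]
    [FiniteDimensional ℝ U] {n : ℕ} (hn : Module.finrank ℝ U = n) (B : U →ₗ[ℝ] U →ₗ[ℝ] ℝ)
    (hsymm : ∀ u v, B u v = B v u) (hpos : ∀ v, v ≠ 0 → 0 < B v v) :
    ∃ ψ : EuclideanSpace ℝ (Fin n) ≃ₗ[ℝ] U, ∀ x, B (ψ x) (ψ x) = ‖x‖ ^ 2 := by
  let core : InnerProductSpace.Core ℝ U :=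
    { inner := fun u v => B u v
      conj_inner_symm := fun u v => hsymm _ _
      re_inner_nonneg := fun v => by
        by_cases hv : v = 0
        · simp [hv]
        · exact (hpos v hv).le
      add_left := fun u v w => by simp
      smul_left := fun u v r => by simp
      definite := fun v hv => by
        by_contra h
        exact (hpos v h).ne' hv }
  let _ : NormedAddCommGroup U := core.toNormedAddCommGroup
  let _ : InnerProductSpace ℝ U := InnerProductSpace.ofCore core.toCore
  let ψ := ((stdOrthonormalBasis ℝ U).reindex (finCongr hn)).repr.symm
  refine ⟨ψ.toLinearEquiv, fun x => ?_⟩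
  have h1 : ‖ψ x‖ ^ 2 = B (ψ x) (ψ x) := (real_inner_self_eq_norm_sq (ψ x)).symm
  exact h1.symm.trans (by rw [ψ.norm_map])

/-- Second-order Taylor expansion. -/
theorem ContDiffAt.taylor_two_isLittleO {E : Type*} [NormedAddCommGroup E] [NormedSpace ℝ E]
    {f : E → ℝ} {p : E} (hf : ContDiffAt ℝ 2 f p) :
    (fun v => f (p + v) - f p - fderiv ℝ f p v - (1 / 2 : ℝ) * fderiv ℝ (fderiv ℝ f) p v v)
      =o[𝓝 0] fun v => ‖v‖ ^ 2 := by
  set H := fderiv ℝ (fderiv ℝ f) p with hH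
  have hsymm (v w : E) : H v w = H w v := by
    have := hf.isSymmSndFDerivAt (by simp)
    exact this v w
  have hf1 : ContDiffAt ℝ 1 (fderiv ℝ f) p := hf.fderiv_right (by norm_num)
  have hf2 : HasFDerivAt (fderiv ℝ f) H p := (hf1.differentiableAt one_ne_zero).hasFDerivAt
  have hdiff : ∀ᶠ z in 𝓝 p, DifferentiableAt ℝ f z :=
    (hf.eventually (by simp)).mono fun z hz => hz.differentiableAt two_ne_zero
  have hadd : Tendsto (fun v : E => p + v) (𝓝 0) (𝓝 p) :=
    Continuous.tendsto' (by fun_prop) _ _ (by simp)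
  rw [Asymptotics.isLittleO_iff]
  intro ε hε
  have h1 := (hasFDerivAt_iff_isLittleO_nhds_zero.1 hf2).def hε
  obtain ⟨δ, hδ, hball⟩ := Metric.eventually_nhds_iff_ball.1 (h1.and (hadd.eventually hdiff))
  filter_upwards [Metric.ball_mem_nhds 0 hδ] with v hv
  set g : E → ℝ := fun v => f (p + v) - f p - fderiv ℝ f p v - (1 / 2 : ℝ) * H v v with hg
  have hderiv (w : E) (hw : w ∈ Metric.ball (0 : E) δ) :
      HasFDerivAt g (fderiv ℝ f (p + w) - fderiv ℝ f p - H w) w := by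
    have h2 : HasFDerivAt (fun v => f (p + v)) (fderiv ℝ f (p + w)) w := by
      have := (hball w hw).2.hasFDerivAt.comp w ((hasFDerivAt_id w).const_add p)
      simpa [Function.comp_def] using this
    have h3 : HasFDerivAt (fun v => H v v) ((2 : ℝ) • H w) w := by
      have := (H.hasFDerivAt (x := w)).clm_apply (hasFDerivAt_id w)
      refine this.congr_fderiv ?_
      ext u
      simp [hsymm u w, two_mul]
    refine (((h2.sub_const (f p)).sub (fderiv ℝ f p).hasFDerivAt).sub
      (h3.const_mul (1 / 2 : ℝ))).congr_fderiv ?_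
    rw [smul_smul]; norm_num
  have hvδ : ‖v‖ < δ := mem_ball_zero_iff.1 hv
  have hsub : Metric.closedBall (0 : E) ‖v‖ ⊆ Metric.ball 0 δ := Metric.closedBall_subset_ball hvδ
  -- The derivative of the remainder `g` is the first-order remainder of `fderiv ℝ f`, bounded by `ε
  -- * ‖v‖` on this ball; the mean value inequality gains the second factor `‖v‖`.
  have hmv := (convex_closedBall (0 : E) ‖v‖).norm_image_sub_le_of_norm_hasFDerivWithin_le
    (f := g) (C := ε * ‖v‖) (fun w hw => (hderiv w (hsub hw)).hasFDerivWithinAt) (fun w hw => ?_)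
    (x := 0) (y := v) (by simp) (by simp)
  · simp only [hg, add_zero, sub_self, map_zero, mul_zero, sub_zero] at hmv
    rw [norm_pow, norm_norm, pow_two, ← mul_assoc]
    simpa using hmv
  · refine (hball w (hsub hw)).1.trans ?_
    gcongr
    exact mem_closedBall_zero_iff.1 hw

/-! ### Definiteness of the paraboloid -/

section Quadrics

variable {V : Type*} [NormedAddCommGroup V] [NormedSpace ℝ V]

/-- The derivatives of a function of the form `l z + d - ∑ (a i z + c i)²`. -/
theorem hasFDerivAt_paraboloid {ι : Type*} [Fintype ι] (l : V →L[ℝ] ℝ) (a : ι → V →L[ℝ] ℝ) (d : ℝ)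
    (c : ι → ℝ) (z : V) :
    HasFDerivAt (fun z => l z + d - ∑ i, (a i z + c i) ^ 2)
      (l - ∑ i, (2 * (a i z + c i)) • a i) z := by
  have h1 (i : ι) : HasFDerivAt (fun z => (a i z + c i) ^ 2) ((2 * (a i z + c i)) • a i) z := by
    simpa [mul_add] using (((a i).hasFDerivAt (x := z)).add_const (c i)).pow 2
  exact (l.hasFDerivAt.add_const d).sub (HasFDerivAt.fun_sum fun i _ => h1 i)

theorem fderiv_fderiv_paraboloid {ι : Type*} [Fintype ι] (l : V →L[ℝ] ℝ) (a : ι → V →L[ℝ] ℝ)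
    (d : ℝ) (c : ι → ℝ) (z v w : V) :
    fderiv ℝ (fderiv ℝ fun z => l z + d - ∑ i, (a i z + c i) ^ 2) z v w =
      -∑ i, 2 * a i v * a i w := by
  have h0 : (fderiv ℝ fun z => l z + d - ∑ i, (a i z + c i) ^ 2) =
      fun z => l - ∑ i, (2 * (a i z + c i)) • a i :=
    funext fun z => (hasFDerivAt_paraboloid l a d c z).fderiv
  have h1 (i : ι) : HasFDerivAt (fun z => (2 * (a i z + c i)) • a i)
      (((2 : ℝ) • a i).smulRight (a i)) z :=
    ((((a i).hasFDerivAt (x := z)).add_const (c i)).const_mul 2).smul_const (a i)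
  have h2 : HasFDerivAt (fun z => l - ∑ i, (2 * (a i z + c i)) • a i)
      (-∑ i, ((2 : ℝ) • a i).smulRight (a i)) z :=
    (HasFDerivAt.fun_sum fun i _ => h1 i).const_sub l
  rw [h0, h2.fderiv]
  simp

end Quadrics

/-- If the whole boundary is affinely equivalent to the paraboloid, all of it is definite. -/
theorem definiteBoundaryPart_eq_frontier {n : ℕ} {Ω : Set (EuclideanSpace ℝ (Fin (n + 1)))}
    (f : EuclideanSpace ℝ (Fin (n + 1)) ≃ᵃ[ℝ] EuclideanSpace ℝ (Fin (n + 1)))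
    (hf : ∀ z, z ∈ frontier Ω ↔ f z ∈ paraboloid n) : definiteBoundaryPart Ω = frontier Ω := by
  refine Subset.antisymm (fun p hp => ?_) fun p hp => ?_
  · obtain ⟨ρ, hρ, -⟩ := hp
    exact hρ.1
  let A : EuclideanSpace ℝ (Fin (n + 1)) →L[ℝ] EuclideanSpace ℝ (Fin (n + 1)) :=
    LinearMap.toContinuousLinearMap (f.linear : _ →ₗ[ℝ] _)
  have hA (v : EuclideanSpace ℝ (Fin (n + 1))) : A v = f.linear v := rfl
  let l : EuclideanSpace ℝ (Fin (n + 1)) →L[ℝ] ℝ := (EuclideanSpace.proj (Fin.last n)).comp A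
  let a (i : Fin n) : EuclideanSpace ℝ (Fin (n + 1)) →L[ℝ] ℝ :=
    (EuclideanSpace.proj i.castSucc).comp A
  have hl (v : EuclideanSpace ℝ (Fin (n + 1))) : l v = f.linear v (Fin.last n) := rfl
  have ha (i : Fin n) (v : EuclideanSpace ℝ (Fin (n + 1))) : a i v = f.linear v i.castSucc := rfl
  have hfz (z : EuclideanSpace ℝ (Fin (n + 1))) : f z = f.linear z + f 0 := by
    simpa using f.map_vadd 0 z
  let d : ℝ := f 0 (Fin.last n)
  let c (i : Fin n) : ℝ := f 0 i.castSucc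
  set ρ : EuclideanSpace ℝ (Fin (n + 1)) → ℝ := fun z => l z + d - ∑ i, (a i z + c i) ^ 2 with hρ
  have hρ0 (z : EuclideanSpace ℝ (Fin (n + 1))) : z ∈ frontier Ω ↔ ρ z = 0 := by
    rw [hf, hρ, sub_eq_zero]
    simp only [paraboloid, mem_ofPred_eq, hfz z]
    rfl
  have hzero (v : EuclideanSpace ℝ (Fin (n + 1))) (hlv : l v = 0) (hav : ∀ i, a i v = 0) :
      v = 0 := by
    rw [← f.linear.map_eq_zero_iff]
    ext i
    refine Fin.lastCases ?_ (fun i => ?_) i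
    · exact hlv
    · exact hav i
  have hder := (hasFDerivAt_paraboloid l a d c p).fderiv
  have hderne : fderiv ℝ ρ p ≠ 0 := by
    intro h0
    have h1 := DFunLike.congr_fun (hder.symm.trans h0)
      (f.linear.symm (EuclideanSpace.single (Fin.last n) 1))
    simp [hl, ha] at h1
  refine ⟨ρ, ⟨hp, ?_, hderne, Eventually.of_forall hρ0⟩, Or.inl fun v hv hv0 => ?_⟩
  · refine ContDiff.contDiffAt ?_
    simp only [hρ]
    fun_prop
  · have hv' : fderiv ℝ ρ p v = 0 := hv
    rw [secondFundamentalForm, fderiv_fderiv_paraboloid, neg_neg]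
    refine div_pos ?_ (norm_pos_iff.2 hderne)
    -- If the form were not positive at `v`, all `a i v` would vanish. Tangency then gives `l v =
    -- 0`, hence `v = 0`.
    by_contra hcon
    have h1 : ∑ i, 2 * a i v * a i v = 0 :=
      le_antisymm (not_lt.1 hcon) (Finset.sum_nonneg fun i _ => by
        nlinarith [mul_self_nonneg (a i v)])
    rw [Finset.sum_eq_zero_iff_of_nonneg fun i _ => by nlinarith [mul_self_nonneg (a i v)]] at h1
    have h2 (i : Fin n) : a i v = 0 := by
      have := h1 i (Finset.mem_univ i)
      rw [mul_assoc] at this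
      simpa using this
    refine hv0 (hzero v ?_ h2)
    rw [hder] at hv'
    simpa [h2] using hv'

/-! ### Coordinates adapted to a definite boundary point -/

/-- A definite boundary point has a defining function with negative definite Hessian on the
tangent hyperplane. -/
theorem exists_definingFunction_neg_definite {m : ℕ} {Ω : Set (EuclideanSpace ℝ (Fin m))}
    {p : EuclideanSpace ℝ (Fin m)} (hp : p ∈ definiteBoundaryPart Ω) :
    ∃ ρ, IsLocalDefiningFunction (frontier Ω) p ρ ∧
      ∀ v, fderiv ℝ ρ p v = 0 → v ≠ 0 → fderiv ℝ (fderiv ℝ ρ) p v v < 0 := by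
  obtain ⟨ρ, ⟨hpS, hρ, hne, hmem⟩, hdef⟩ := hp
  have hnorm : 0 < ‖fderiv ℝ ρ p‖ := norm_pos_iff.2 hne
  rcases hdef with h | h
  · refine ⟨ρ, ⟨hpS, hρ, hne, hmem⟩, fun v hv hv0 => ?_⟩
    have h1 := h v hv hv0
    rw [secondFundamentalForm, div_pos_iff_of_pos_right hnorm] at h1
    linarith
  · have hneg : fderiv ℝ (fun z => -ρ z) = fun z => -fderiv ℝ ρ z := funext fun z => fderiv_fun_neg
    refine ⟨fun z => -ρ z, ⟨hpS, hρ.neg, ?_, ?_⟩, fun v hv hv0 => ?_⟩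
    · rw [hneg]
      simpa using hne
    · simpa using hmem
    · rw [hneg] at hv ⊢
      have hv' : fderiv ℝ ρ p v = 0 := by simpa using hv
      have h1 := h v hv' hv0
      rw [secondFundamentalForm] at h1
      rw [fderiv_fun_neg]
      by_contra hcon
      exact h1.not_ge (div_nonneg (not_lt.1 hcon) hnorm.le)

/-- The second-order Taylor polynomial is `z.2 - ‖z.1‖² + z.2 * m z`, where `m z → 0` collects the
Hessian terms involving the transversal direction. This term and the remainder `o(‖z‖²)` are
negligible for the weights, since `‖z‖² ≤ ‖z.1‖² + |z.2|` near the origin. -/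
theorem isParabolicDefiningFunction_of_hessian {E F : Type*} [NormedAddCommGroup E]
    [NormedSpace ℝ E] [NormedAddCommGroup F] [InnerProductSpace ℝ F] {S : Set E} {ρ : E → ℝ} {p : E}
    (hρ : ContDiffAt ℝ 2 ρ p) (hmem : ∀ᶠ x in 𝓝 p, x ∈ S ↔ ρ x = 0) (h0 : ρ p = 0)
    (Φ : F × ℝ →L[ℝ] E) (h1 : ∀ z, fderiv ℝ ρ p (Φ z) = z.2)
    (h2 : ∀ x, fderiv ℝ (fderiv ℝ ρ) p (Φ (x, 0)) (Φ (x, 0)) = -2 * ‖x‖ ^ 2) :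
    IsParabolicDefiningFunction {z | p + Φ z ∈ S} (fun z => ρ (p + Φ z)) := by
  have hcont : Continuous fun z => p + Φ z := by fun_prop
  have ht : Tendsto (fun z => p + Φ z) (𝓝 0) (𝓝 p) := hcont.tendsto' _ _ (by simp)
  have hΦ : Tendsto Φ (𝓝 0) (𝓝 0) := Φ.continuous.tendsto' _ _ (map_zero Φ)
  refine ⟨ht.eventually hmem, ?_, fun ε hε => ?_⟩
  · filter_upwards [ht.eventually (hρ.eventually (by simp))] with z hz
    exact ContinuousAt.comp (f := fun z => p + Φ z) hz.continuousAt hcont.continuousAt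
  set H := fderiv ℝ (fderiv ℝ ρ) p with hH
  have hsymm (v w : E) : H v w = H w v := hρ.isSymmSndFDerivAt (by simp) v w
  have hδ : 0 < ε / (4 * (‖Φ‖ ^ 2 + 1)) := by positivity
  have htaylor := hΦ.eventually (hρ.taylor_two_isLittleO.def hδ)
  set m : F × ℝ → ℝ := fun z => H (Φ (z.1, 0)) (Φ (0, 1)) + (1 / 2) * z.2 * H (Φ (0, 1)) (Φ (0, 1))
    with hm
  have hmc : Tendsto (fun z : F × ℝ => |m z|) (𝓝 0) (𝓝 0) := by
    refine Continuous.tendsto' ?_ _ _ ?_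
    · have hc : Continuous fun z : F × ℝ => H (Φ (z.1, 0)) :=
        H.continuous.comp (Φ.continuous.comp (by fun_prop))
      exact ((hc.clm_apply continuous_const).add (by fun_prop)).abs
    · have : ((0 : F), (0 : ℝ)) = 0 := rfl
      simp [hm, this]
  have hsmall : ∀ᶠ z : F × ℝ in 𝓝 0, |z.2| ≤ 1 :=
    (((by fun_prop : Continuous fun z : F × ℝ => |z.2|).tendsto' 0 0 (by simp)).eventually
      (gt_mem_nhds one_pos)).mono fun z hz => hz.le
  filter_upwards [htaylor, hmc.eventually (gt_mem_nhds (half_pos hε)), hsmall] with z hz1 hz2 hz3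
  have hz : z = (z.1, 0) + z.2 • (0, 1) := by ext <;> simp
  have hHz : H (Φ z) (Φ z) = -2 * ‖z.1‖ ^ 2 + 2 * (z.2 * m z) := by
    have h3 : Φ z = Φ (z.1, 0) + z.2 • Φ (0, 1) := by rw [← map_smul, ← map_add, ← hz]
    rw [h3]
    simp only [map_add, map_smul, add_apply, smul_apply, smul_eq_mul, h2, hm,
      hsymm (Φ (0, 1)) (Φ (z.1, 0))]
    ring
  rw [h0, sub_zero, h1, hHz, Real.norm_eq_abs, norm_pow, norm_norm] at hz1
  have hnorm : ‖z‖ ^ 2 ≤ ‖z.1‖ ^ 2 + |z.2| := by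
    have h4 : |z.2| ^ 2 ≤ |z.2| := by
      rw [pow_two]; exact mul_le_of_le_one_left (abs_nonneg _) hz3
    rw [Prod.norm_def]
    rcases max_cases ‖z.1‖ ‖z.2‖ with h5 | h5
    · rw [h5.1]; linarith [abs_nonneg z.2]
    · rw [h5.1, Real.norm_eq_abs]; linarith [sq_nonneg ‖z.1‖]
  have hΦz : ε / (4 * (‖Φ‖ ^ 2 + 1)) * ‖Φ z‖ ^ 2 ≤ ε / 4 * (‖z.1‖ ^ 2 + |z.2|) := by
    calc ε / (4 * (‖Φ‖ ^ 2 + 1)) * ‖Φ z‖ ^ 2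
        ≤ ε / (4 * (‖Φ‖ ^ 2 + 1)) * (‖Φ‖ * ‖z‖) ^ 2 := by gcongr; exact Φ.le_opNorm z
      _ = ε / (4 * (‖Φ‖ ^ 2 + 1)) * (‖Φ‖ ^ 2 * ‖z‖ ^ 2) := by rw [mul_pow]
      _ ≤ ε / (4 * (‖Φ‖ ^ 2 + 1)) * ((‖Φ‖ ^ 2 + 1) * (‖z.1‖ ^ 2 + |z.2|)) := by
        gcongr; linarith
      _ = ε / 4 * (‖z.1‖ ^ 2 + |z.2|) := by field_simp
  have hzm : |z.2 * m z| ≤ ε / 2 * |z.2| := by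
    rw [abs_mul, mul_comm]; gcongr
  have h6 := hz1.trans hΦz
  have h7 : 0 ≤ ε * ‖z.1‖ ^ 2 := by positivity
  have h8 : 0 ≤ ε * |z.2| := by positivity
  rw [abs_le] at h6 hzm ⊢
  constructor <;> linarith

/-- Linear coordinates at a definite boundary point in which the tangent hyperplane is horizontal
and the second fundamental form is standard. -/
theorem exists_adapted_coordinates {n : ℕ} {E : Type*} [NormedAddCommGroup E] [NormedSpace ℝ E]
    [FiniteDimensional ℝ E] (hn : Module.finrank ℝ E = n + 1) (ℓ : E →L[ℝ] ℝ) (hℓ : ℓ ≠ 0)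
    (H : E →L[ℝ] E →L[ℝ] ℝ) (hsymm : ∀ v w, H v w = H w v)
    (hneg : ∀ v, ℓ v = 0 → v ≠ 0 → H v v < 0) :
    ∃ Φ : (EuclideanSpace ℝ (Fin n) × ℝ) ≃L[ℝ] E, (∀ z, ℓ (Φ z) = z.2) ∧
      ∀ x, H (Φ (x, 0)) (Φ (x, 0)) = -2 * ‖x‖ ^ 2 := by
  set U : Submodule ℝ E := LinearMap.ker (ℓ : E →ₗ[ℝ] ℝ) with hU
  have hℓ' : (ℓ : E →ₗ[ℝ] ℝ) ≠ 0 := fun h => hℓ (ContinuousLinearMap.coe_injective h)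
  have hrank : Module.finrank ℝ U = n := by
    have h1 := Module.Dual.finrank_ker_add_one_of_ne_zero hℓ'
    rw [hn] at h1
    exact Nat.succ_injective h1
  -- The factor `-1/2` turns the Taylor term `H / 2` into `-‖x‖²`.
  let Hl : E →ₗ[ℝ] E →ₗ[ℝ] ℝ :=
    LinearMap.mk₂ ℝ (fun v w => -(1 / 2) * H v w) (fun u v w => by simp; ring)
      (fun c v w => by simp; ring) (fun u v w => by simp; ring) (fun c v w => by simp; ring)
  have hHl (v w : E) : Hl v w = -(1 / 2) * H v w := rfl
  obtain ⟨ψ, hψ⟩ := exists_linearEquiv_norm_sq_eq hrank (Hl.domRestrict₁₂ U U)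
    (fun u v => by
      rw [LinearMap.domRestrict₁₂_apply, LinearMap.domRestrict₁₂_apply, hHl, hHl, hsymm])
    (fun v hv => by
      have h1 := hneg v v.2 (by simpa using hv)
      rw [LinearMap.domRestrict₁₂_apply, hHl]
      linarith)
  obtain ⟨e₀, he₀⟩ : ∃ e₀, ℓ e₀ ≠ 0 := by
    by_contra hcon
    push Not at hcon
    exact hℓ (ContinuousLinearMap.ext hcon)
  set e := (ℓ e₀)⁻¹ • e₀ with he
  have hℓe : ℓ e = 1 := by simp [he, he₀]
  have hψℓ (x : EuclideanSpace ℝ (Fin n)) : ℓ (ψ x : E) = 0 := (ψ x).2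
  let Φ₀ : EuclideanSpace ℝ (Fin n) × ℝ →ₗ[ℝ] E :=
    (U.subtype ∘ₗ (ψ : EuclideanSpace ℝ (Fin n) →ₗ[ℝ] U)).coprod (LinearMap.toSpanSingleton ℝ E e)
  have hΦ₀ (z : EuclideanSpace ℝ (Fin n) × ℝ) : Φ₀ z = ψ z.1 + z.2 • e := rfl
  have hℓΦ (z : EuclideanSpace ℝ (Fin n) × ℝ) : ℓ (Φ₀ z) = z.2 := by
    rw [hΦ₀, map_add, hψℓ, map_smul, hℓe]; simp
  have hinj : Function.Injective Φ₀ := by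
    rw [injective_iff_map_eq_zero]
    intro z hz
    have h1 : z.2 = 0 := by rw [← hℓΦ, hz, map_zero]
    rw [hΦ₀, h1, zero_smul, add_zero] at hz
    exact Prod.ext (by simpa using hz) h1
  have hfin : Module.finrank ℝ (EuclideanSpace ℝ (Fin n) × ℝ) = Module.finrank ℝ E := by
    rw [hn]; simp
  refine ⟨(LinearEquiv.ofInjectiveOfFinrankEq Φ₀ hinj hfin).toContinuousLinearEquiv, hℓΦ,
    fun x => ?_⟩
  have h1 := hψ x
  rw [LinearMap.domRestrict₁₂_apply, hHl] at h1
  have h2 : Φ₀ (x, 0) = ψ x := by rw [hΦ₀]; simp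
  change H (Φ₀ (x, 0)) (Φ₀ (x, 0)) = _
  rw [h2]
  linarith

/-- Appending a last coordinate. -/
theorem exists_linearEquiv_snoc (n : ℕ) :
    ∃ J : (EuclideanSpace ℝ (Fin n) × ℝ) ≃ₗ[ℝ] EuclideanSpace ℝ (Fin (n + 1)),
      ∀ z, J z ∈ paraboloid n ↔ z.2 = ‖z.1‖ ^ 2 := by
  let J : (EuclideanSpace ℝ (Fin n) × ℝ) ≃ₗ[ℝ] EuclideanSpace ℝ (Fin (n + 1)) :=
    { toFun := fun z => WithLp.toLp 2 (Fin.snoc (α := fun _ => ℝ) z.1 z.2)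
      invFun := fun v => (WithLp.toLp 2 fun i => v i.castSucc, v (Fin.last n))
      map_add' := fun z w => by
        ext i
        refine Fin.lastCases ?_ (fun i => ?_) i <;> simp
      map_smul' := fun c z => by
        ext i
        refine Fin.lastCases ?_ (fun i => ?_) i <;> simp
      left_inv := fun z => by
        ext <;> simp
      right_inv := fun v => by
        ext i
        refine Fin.lastCases ?_ (fun i => ?_) i <;> simp }
  have hlast (z : EuclideanSpace ℝ (Fin n) × ℝ) : J z (Fin.last n) = z.2 :=
    Fin.snoc_last (α := fun _ => ℝ) _ _
  have hcast (z : EuclideanSpace ℝ (Fin n) × ℝ) (i : Fin n) : J z i.castSucc = z.1 i :=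
    Fin.snoc_castSucc (α := fun _ => ℝ) _ _ _
  refine ⟨J, fun z => ?_⟩
  simp only [paraboloid, mem_ofPred_eq, hlast, hcast, EuclideanSpace.real_norm_sq_eq]

/-! ### Return to the original coordinates -/

theorem isOpen_of_isOpen_tube {m : ℕ} {Ω : Set (EuclideanSpace ℝ (Fin m))} (h : IsOpen (tube Ω)) :
    IsOpen Ω := by
  have hc : Continuous fun x : EuclideanSpace ℝ (Fin m) =>
      (WithLp.toLp 2 (fun i => (x i : ℂ)) : EuclideanSpace ℂ (Fin m)) := by
    refine (PiLp.continuous_toLp 2 _).comp (continuous_pi fun i => ?_)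
    fun_prop
  exact h.preimage hc

/-- The boundary of an affinely homogeneous open set with a definite boundary point is affinely
equivalent to the paraboloid. -/
theorem exists_affineEquiv_frontier_paraboloid {n : ℕ} (hn : 1 ≤ n)
    {Ω : Set (EuclideanSpace ℝ (Fin (n + 1)))} (hΩ : IsOpen Ω) (hhom : IsAffinelyHomogeneous Ω)
    {p : EuclideanSpace ℝ (Fin (n + 1))} (hp : p ∈ definiteBoundaryPart Ω) :
    ∃ f : EuclideanSpace ℝ (Fin (n + 1)) ≃ᵃ[ℝ] EuclideanSpace ℝ (Fin (n + 1)),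
      ∀ z, z ∈ frontier Ω ↔ f z ∈ paraboloid n := by
  have : Nonempty (Fin n) := ⟨⟨0, hn⟩⟩
  obtain ⟨ρ, ⟨hpS, hρ, hne, hmem⟩, hneg⟩ := exists_definingFunction_neg_definite hp
  obtain ⟨Φ, hΦ1, hΦ2⟩ := exists_adapted_coordinates (n := n) (by simp) _ hne
    (fderiv ℝ (fderiv ℝ ρ) p) (fun v w => hρ.isSymmSndFDerivAt (by simp) v w) hneg
  have hpar := isParabolicDefiningFunction_of_hessian hρ hmem (hmem.self_of_nhds.1 hpS)
    (Φ : EuclideanSpace ℝ (Fin n) × ℝ →L[ℝ] _) hΦ1 hΦ2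
  simp only [ContinuousLinearEquiv.coe_coe] at hpar
  let τ : (EuclideanSpace ℝ (Fin n) × ℝ) ≃ᵃ[ℝ] EuclideanSpace ℝ (Fin (n + 1)) :=
    Φ.toLinearEquiv.toAffineEquiv.trans (AffineEquiv.constVAdd ℝ _ p)
  have hτ (z : EuclideanSpace ℝ (Fin n) × ℝ) : τ z = p + Φ z := rfl
  let h : (EuclideanSpace ℝ (Fin n) × ℝ) ≃ₜ EuclideanSpace ℝ (Fin (n + 1)) :=
    Φ.toHomeomorph.trans (Homeomorph.addLeft p)
  have hfr : {z | p + Φ z ∈ frontier Ω} = frontier (τ ⁻¹' Ω) := h.preimage_frontier Ω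
  rw [hfr] at hpar
  have hder : HasStrictFDerivAt (fun z => ρ (p + Φ z))
      (ContinuousLinearMap.snd ℝ (EuclideanSpace ℝ (Fin n)) ℝ) 0 := by
    have h1 : HasStrictFDerivAt ρ (fderiv ℝ ρ p) (p + Φ 0) := by
      rw [map_zero, add_zero]
      exact hρ.hasStrictFDerivAt two_ne_zero
    have h2 : HasStrictFDerivAt (fun z => p + Φ z)
        (Φ : EuclideanSpace ℝ (Fin n) × ℝ →L[ℝ] _) 0 := Φ.hasStrictFDerivAt.const_add p
    refine (h1.comp 0 h2).congr_fderiv ?_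
    exact ContinuousLinearMap.ext hΦ1
  have hhom' : ∀ x ∈ τ ⁻¹' Ω, ∀ y ∈ τ ⁻¹' Ω,
      ∃ g : (EuclideanSpace ℝ (Fin n) × ℝ) ≃ᵃ[ℝ] (EuclideanSpace ℝ (Fin n) × ℝ),
        g '' (τ ⁻¹' Ω) = τ ⁻¹' Ω ∧ g x = y := by
    intro x hx y hy
    obtain ⟨g, hg, hgxy⟩ := hhom (τ x) hx (τ y) hy
    have hg' : g '' Ω = Ω := hg
    refine ⟨(τ.trans g).trans τ.symm, ?_, ?_⟩
    · have h1 : ((τ.trans g).trans τ.symm : EuclideanSpace ℝ (Fin n) × ℝ → _) =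
          τ.symm ∘ g ∘ τ := rfl
      have h2 : τ ⁻¹' Ω = τ.symm '' Ω := (τ.symm.toEquiv.image_eq_preimage_symm Ω).symm
      rw [h1, image_comp, image_comp, image_preimage_eq _ τ.surjective, hg', h2]
    · change τ.symm (g (τ x)) = y
      rw [hgxy, τ.symm_apply_apply]
  have hmem0 : 0 ∈ frontier (τ ⁻¹' Ω) := by
    rw [← hfr, mem_ofPred_eq, map_zero, add_zero]
    exact hpS
  obtain ⟨b, hb⟩ := frontier_eq_paraboloid (Ω := τ ⁻¹' Ω) (h.continuous.isOpen_preimage _ hΩ)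
    hhom' hmem0 hpar hder
  obtain ⟨J, hJ⟩ := exists_linearEquiv_snoc n
  -- The shear taking `z.2 = ‖z.1 - z.2 • b‖ ^ 2` to the standard paraboloid.
  let σ : (EuclideanSpace ℝ (Fin n) × ℝ) ≃ₗ[ℝ] (EuclideanSpace ℝ (Fin n) × ℝ) :=
    { toFun := fun z => (z.1 - z.2 • b, z.2)
      invFun := fun z => (z.1 + z.2 • b, z.2)
      map_add' := fun z w => by
        ext1
        · simp only [Prod.fst_add, Prod.snd_add]; module
        · rfl
      map_smul' := fun c z => by
        ext1
        · simp only [Prod.smul_fst, Prod.smul_snd, RingHom.id_apply, smul_eq_mul]; module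
        · rfl
      left_inv := fun z => by ext1 <;> simp
      right_inv := fun z => by ext1 <;> simp }
  refine ⟨τ.symm.trans (σ.trans J).toAffineEquiv, fun z => ?_⟩
  have h1 : (τ.symm.trans (σ.trans J).toAffineEquiv) z = J (σ (τ.symm z)) := rfl
  have h2 : z ∈ frontier Ω ↔ τ.symm z ∈ frontier (τ ⁻¹' Ω) := by
    rw [← hfr, mem_ofPred_eq, ← hτ, τ.apply_symm_apply]
  rw [h1, hJ, h2, hb]
  rfl

theorem theorem1 (n : ℕ) (hn : 1 ≤ n)
    (D : Set (EuclideanSpace ℂ (Fin (n + 1)))) (hD_open : IsOpen D) (hD_conn : IsConnected D)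
    (Ω : Set (EuclideanSpace ℝ (Fin (n + 1)))) (hD : D = tube Ω)
    (hΩ : IsAffinelyHomogeneous Ω)
    (Γ : Set (EuclideanSpace ℝ (Fin (n + 1)))) (hΓ_ne : Γ.Nonempty)
    (hΓ_open : ∃ U : Set (EuclideanSpace ℝ (Fin (n + 1))), IsOpen U ∧ Γ = U ∩ frontier Ω)
    (hΓ_def : Γ ⊆ definiteBoundaryPart Ω)
    (hΓ_trans : ActsLocallyTransitivelyOn Ω Γ) :
    ∃ f : EuclideanSpace ℝ (Fin (n + 1)) ≃ᵃ[ℝ] EuclideanSpace ℝ (Fin (n + 1)),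
      f '' definiteBoundaryPart Ω = paraboloid n := by
  obtain ⟨p, hp⟩ := hΓ_ne
  obtain ⟨f, hf⟩ := exists_affineEquiv_frontier_paraboloid hn
    (isOpen_of_isOpen_tube (hD ▸ hD_open)) hΩ (hΓ_def hp)
  refine ⟨f, ?_⟩
  have h : frontier Ω = f ⁻¹' paraboloid n := Set.ext hf
  rw [definiteBoundaryPart_eq_frontier f hf, h, image_preimage_eq _ f.surjective]
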